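/- **Model.** A source serves $M$ users with the help of $L\ge 1$ relays over blocks $k=0,1,2,\dots$. In block $k$ the links source–user $i$, source–relay $l$, relay $l$–user $i$ have power gains $\gamma_{sd_i}[k],\gamma_{sr_l}[k],\gamma_{r_ld_i}[k]\ge 0$. All gains are independent across links and blocks and, for each link, identically distributed over the blocks with a continuous distribution function; $\mathbb E\log(1+\gamma_{sd_i})<\infty$ and $\mathbb E\log(1+\gamma_{sr_l})<\infty$. Logarithms are natural. Let $\mu_i\ge 0$, $\sum_i\mu_i=1$, $\bar P>0$. *Relay-assisted problem.* In each block one chooses, for every user $i$, access ratios $\tau_i^{DT},\tau_i^{DF}\ge 0$ with $\sum_i(\tau_i^{DT}+\tau_i^{DF})=1$, a relay $l(i)$, and powers $P_i^{DT},P_{s,i},P_{r,i}\ge 0$. The rate of user $i$ in the block is $$\tau_i^{DT}\log(1+\gamma_{sd_i}P_i^{DT})+\tau_i^{DF}\min\{\tfrac12\log(1+\gamma_{sr_{l(i)}}P_{s,i}),\ \tfrac12\log(1+\gamma_{sd_i}P_{s,i}+\gamma_{r_{l(i)}d_i}P_{r,i})\}$$ and the power used is $\sum_i\big(\tau_i^{DT}P_i^{DT}+\tau_i^{DF}(\tfrac12P_{s,i}+\tfrac12P_{r,i})\big)$.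 The problem is to maximize the long-term average, over all blocks, of the $\mu$-weighted sum rate subject to long-term average power at most $\bar P$. (Long-term averages are limits of averages over the first $K$ blocks as $K\to\infty$; where the limit is not assumed to exist, the limit superior is used.) *Virtual-user problem.* Put $\gamma'_{sr_l}=\gamma_{sr_l}/\gamma_{sd_i}$, $\gamma'_{r_ld_i}=\gamma_{r_ld_i}/\gamma_{sd_i}$. Relay $l$ is useful for $i$ if both exceed $1$; its gain is then $\frac{\gamma'_{sr_l}\gamma'_{r_ld_i}}{\gamma'_{sr_l}+\gamma'_{r_ld_i}-1}$, and $\alpha_i$ is the largest gain over the useful relays of $i$. There is no relay; each user $i$ is replaced by a DT virtual user with $\omega_j=\mu_i$, $\eta_j=\gamma_{sd_i}$ and, in blocks in which $i$ has a useful relay, a DF virtual user with $\omega_j=\mu_i/2$, $\eta_j=2\alpha_i\gamma_{sd_i}$. Let $f_j(P)=\omega_j\log(1+\eta_jP)$. In each block one chooses $\tau_j,P_j\ge0$, $\sum_j\tau_j=1$, and one maximizes the long-term average of $\sum_j\tau_jf_j(P_j)$ subject to the long-term average of $\sum_j\tau_jP_j$ being at most $\bar P$. The rate of user $i$ is $\tau_j\log(1+\eta_jP_j)$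 for its DT virtual user plus $\tfrac12\tau_j\log(1+\eta_jP_j)$ for its DF virtual user. **Claim 1 (equivalence).** Almost surely all gains are positive. For every sequence of positive gains, both problems have the same set of achievable long-term average user-rate vectors and the same set of attainable long-term weighted sum rates. Given an allocation of the virtual problem, keep the ratios and the DT powers, use for each present DF user a relay $l$ of largest gain, and split its power $P$ as $P_s=2P\big/\big(1+\frac{\gamma'_{sr_l}-1}{\gamma'_{r_ld_i}}\big)$, $P_r=2P-P_s$. Such a relay allocation exists, has in every block the same power and the same rate for every user, and is optimal over the blocks if and only if the virtual allocation is. **Claim 2 (optimal policy).** There is $\lambda_G>0$ such that, with $P_j=\big[\frac{\omega_j}{\lambda_G}-\frac1{\eta_j}\big]^+$, the following hold. 1. Almost surely, in every block, a virtual user $m$ maximizing $f_j(P_j)-\lambda_GP_j$ over the present virtual users is unique if $P_m>0$. 2. Giving in each block the whole block and the power $P_m$ to a single maximizer $m$ can be done by a measurable function of the current fading state. Almost surely, any such allocation sequence has long-term average power exactly $\bar P$, has convergent long-term average rates with non-random limits $R_i$ and long-term weighted sum rate $\sum_i\mu_iR_i$, and is optimal among all sequences of allocations of the virtual problem; carried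 out as in Claim 1 it is optimal for the relay-assisted problem. 3. The optimal policy is unique in both problems: any policy that is a measurable function of the current fading state and is almost surely optimal coincides almost surely, in every block, with the policy of item 2 (carried out as in Claim 1 in the relay-assisted problem), in the ratios, powers and relays of all sub-channels that carry power. -/

import Mathlib

open MeasureTheory ProbabilityTheory Filter Topology

noncomputable section

namespace RelayBC

/-! ## Channel model -/

/-- The links of the network with `M` users and `L` relays: source to user `i`,
source to relay `l`, and relay `l` to user `i`. -/
abbrev Link (M L : ℕ) : Type := Fin M ⊕ Fin L ⊕ (Fin L × Fin M)

/-- The fading state of one channel block: the effective power gain of every link. -/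
abbrev Fading (M L : ℕ) : Type := Link M L → ℝ

abbrev Link.sd {M L : ℕ} (i : Fin M) : Link M L := Sum.inl i
abbrev Link.sr {M L : ℕ} (l : Fin L) : Link M L := Sum.inr (Sum.inl l)
abbrev Link.rd {M L : ℕ} (l : Fin L) (i : Fin M) : Link M L := Sum.inr (Sum.inr (l, i))

variable {M L : ℕ}

/-- All link gains are strictly positive. -/
def Fading.Positive (s : Fading M L) : Prop := ∀ e, 0 < s e

/-! ## Long-term averages -/

/-- The average of the first `K` blocks. -/
def blockAvg (x : ℕ → ℝ) (K : ℕ) : ℝ := (∑ k ∈ Finset.range K, x k) / K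

/-- The long-term average over `K → ∞` blocks. It is the limit whenever the limit exists;
in general it is the limit superior, in the extended reals. -/
def longTermAvg (x : ℕ → ℝ) : EReal := limsup (fun K => (blockAvg x K : EReal)) atTop

/-- A sequence of block allocations that is admissible in every block and whose long-term
average power does not exceed `Pbar`. -/
def IsFeasibleSeq {α : Type} (adm : ℕ → α → Prop) (pow : α → ℝ) (Pbar : ℝ) (a : ℕ → α) : Prop :=
  (∀ k, adm k (a k)) ∧ longTermAvg (fun k => pow (a k)) ≤ (Pbar : EReal)

/-- A feasible sequence of block allocations that maximizes the long-term average of the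
objective `obj` among all feasible sequences. -/
def IsOptimalSeq {α : Type} (adm : ℕ → α → Prop) (pow : α → ℝ) (obj : ℕ → α → ℝ) (Pbar : ℝ)
    (a : ℕ → α) : Prop :=
  IsFeasibleSeq adm pow Pbar a ∧
    ∀ b, IsFeasibleSeq adm pow Pbar b →
      longTermAvg (fun k => obj k (b k)) ≤ longTermAvg (fun k => obj k (a k))

/-- The set of long-term average rate vectors of the `M` users that are achieved by feasible
sequences of allocations. -/
def rateRegion {α : Type} (adm : ℕ → α → Prop) (pow : α → ℝ) (rate : ℕ → α → Fin M → ℝ)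
    (Pbar : ℝ) : Set (Fin M → ℝ) :=
  {R | ∃ a, IsFeasibleSeq adm pow Pbar a ∧
    ∀ i, Tendsto (blockAvg fun k => rate k (a k) i) atTop (𝓝 (R i))}

/-! ## The relay-assisted problem -/

/-- An allocation of one block in the relay-assisted channel: the channel access ratios of the
direct (DT) and decode-and-forward (DF) links of every user, the relay of every user, the source
power on the DT link, and the source power (first sub-slot) and relay power (second sub-slot) on
the DF link. -/
structure RelayAlloc (M L : ℕ) where
  shareDT : Fin M → ℝ
  shareDF : Fin M → ℝ
  relay : Fin M → Fin L
  powerDT : Fin M → ℝ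
  powerS : Fin M → ℝ
  powerR : Fin M → ℝ

namespace RelayAlloc

/-- Ratios and powers are nonnegative and the ratios add up to one. -/
def Admissible (A : RelayAlloc M L) : Prop :=
  (∀ i, 0 ≤ A.shareDT i ∧ 0 ≤ A.shareDF i ∧ 0 ≤ A.powerDT i ∧ 0 ≤ A.powerS i ∧ 0 ≤ A.powerR i) ∧
    ∑ i, (A.shareDT i + A.shareDF i) = 1

/-- The total power (source and relays) used in the block. -/
def power (A : RelayAlloc M L) : ℝ :=
  ∑ i, (A.shareDT i * A.powerDT i + A.shareDF i * (A.powerS i / 2 + A.powerR i / 2))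

/-- Rate of the direct link of user `i`. -/
def rateDT (s : Fading M L) (A : RelayAlloc M L) (i : Fin M) : ℝ :=
  Real.log (1 + s (Link.sd i) * A.powerDT i)

/-- Rate of the regenerative decode-and-forward link of user `i`. -/
def rateDF (s : Fading M L) (A : RelayAlloc M L) (i : Fin M) : ℝ :=
  min (1 / 2 * Real.log (1 + s (Link.sr (A.relay i)) * A.powerS i))
    (1 / 2 * Real.log
      (1 + s (Link.sd i) * A.powerS i + s (Link.rd (A.relay i) i) * A.powerR i))

/-- Total rate of user `i` in the block. -/
def rate (s : Fading M L) (A : RelayAlloc M L) (i : Fin M) : ℝ :=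
  A.shareDF i * rateDF s A i + A.shareDT i * rateDT s A i

/-- Weighted sum rate of the block. -/
def objective (μ : Fin M → ℝ) (s : Fading M L) (A : RelayAlloc M L) : ℝ :=
  ∑ i, μ i * A.rate s i

open Classical in
/-- The access ratio and power of the direct link of user `i`, if that link carries power. -/
def activeDT (A : RelayAlloc M L) (i : Fin M) : Option (ℝ × ℝ) :=
  if 0 < A.shareDT i ∧ 0 < A.powerDT i then some (A.shareDT i, A.powerDT i) else none

open Classical in
/-- The relay, access ratio, source power and relay power of the decode-and-forward link of
user `i`, if that link carries power. -/
def activeDF (A : RelayAlloc M L) (i : Fin M) : Option (Fin L × ℝ × ℝ × ℝ) :=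
  if 0 < A.shareDF i ∧ 0 < A.powerS i + A.powerR i then
    some (A.relay i, A.shareDF i, A.powerS i, A.powerR i) else none

/-- A measurable assignment of admissible allocations to fading states. -/
def IsPolicy (p : Fading M L → RelayAlloc M L) : Prop :=
  (∀ s, s.Positive → (p s).Admissible) ∧
    ∀ i, Measurable (fun s => (p s).shareDT i) ∧ Measurable (fun s => (p s).shareDF i) ∧
      Measurable (fun s => (p s).relay i) ∧ Measurable (fun s => (p s).powerDT i) ∧
      Measurable (fun s => (p s).powerS i) ∧ Measurable (fun s => (p s).powerR i)

/-- `A` solves the relay-assisted problem for the realization `g` of the fading sequence. -/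
def IsOptimal (μ : Fin M → ℝ) (Pbar : ℝ) (g : ℕ → Fading M L) (A : ℕ → RelayAlloc M L) : Prop :=
  IsOptimalSeq (fun _ B => B.Admissible) power (fun k B => B.objective μ (g k)) Pbar A

/-- The achievable rates region of the relay-assisted channel. -/
def region (Pbar : ℝ) (g : ℕ → Fading M L) : Set (Fin M → ℝ) :=
  rateRegion (fun _ B => B.Admissible) (power (M := M) (L := L)) (fun k B => B.rate (g k)) Pbar

/-- The long-term weighted sum rates attained by feasible sequences of allocations. -/
def values (μ : Fin M → ℝ) (Pbar : ℝ) (g : ℕ → Fading M L) : Set EReal :=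
  {v | ∃ A : ℕ → RelayAlloc M L, IsFeasibleSeq (fun _ B => B.Admissible) power Pbar A ∧
    v = longTermAvg fun k => (A k).objective μ (g k)}

end RelayAlloc

/-! ## Useful relays and relay selection -/

/-- Relay `l` is useful for user `i`. -/
def Useful (s : Fading M L) (i : Fin M) (l : Fin L) : Prop :=
  1 < s (Link.sr l) / s (Link.sd i) ∧ 1 < s (Link.rd l i) / s (Link.sd i)

/-- The power gain of the decode-and-forward link of user `i` through relay `l`. -/
def gain (s : Fading M L) (i : Fin M) (l : Fin L) : ℝ :=
  (s (Link.sr l) / s (Link.sd i)) * (s (Link.rd l i) / s (Link.sd i)) /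
    (s (Link.sr l) / s (Link.sd i) + s (Link.rd l i) / s (Link.sd i) - 1)

/-- `l` has the largest power gain among the useful relays of user `i`. -/
def IsBestRelay (s : Fading M L) (i : Fin M) (l : Fin L) : Prop :=
  Useful s i l ∧ ∀ l', Useful s i l' → gain s i l' ≤ gain s i l

/-- The best power gain of user `i`: the maximum over its useful relays (used only when there
is one). -/
def bestGain (s : Fading M L) (i : Fin M) : ℝ := sSup {x | ∃ l, Useful s i l ∧ x = gain s i l}

/-! ## The broadcast problem with virtual users -/

/-- The virtual users: `Sum.inl i` is the DT user and `Sum.inr i` the DF user of user `i`. -/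
abbrev VUser (M : ℕ) : Type := Fin M ⊕ Fin M

/-- The DF virtual user of `i` is present only when `i` has a useful relay. -/
def Present (s : Fading M L) : VUser M → Prop
  | Sum.inl _ => True
  | Sum.inr i => ∃ l, Useful s i l

/-- The weight of a virtual user. -/
def omega (μ : Fin M → ℝ) : VUser M → ℝ
  | Sum.inl i => μ i
  | Sum.inr i => μ i / 2

/-- The channel quality of a virtual user. -/
def eta (s : Fading M L) : VUser M → ℝ
  | Sum.inl i => s (Link.sd i)
  | Sum.inr i => 2 * s (Link.sd i) * bestGain s i

/-- The weighted rate of a virtual user with power `P`. -/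
def f (μ : Fin M → ℝ) (s : Fading M L) (j : VUser M) (P : ℝ) : ℝ :=
  omega μ j * Real.log (1 + eta s j * P)

/-- An allocation of one block in the broadcast channel with virtual users: access ratios and
powers. -/
structure VirtualAlloc (M : ℕ) where
  share : VUser M → ℝ
  pow : VUser M → ℝ

namespace VirtualAlloc

/-- Ratios and powers are nonnegative, the ratios add up to one, and virtual users that are not
present get no share. -/
def Admissible (s : Fading M L) (a : VirtualAlloc M) : Prop :=
  (∀ j, 0 ≤ a.share j ∧ 0 ≤ a.pow j) ∧ ∑ j, a.share j = 1 ∧ ∀ j, ¬ Present s j → a.share j = 0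

/-- The total power used in the block. -/
def power (a : VirtualAlloc M) : ℝ := ∑ j, a.share j * a.pow j

/-- The (unweighted) rate of the actual user `i`, summed over its two virtual users. -/
def rate (s : Fading M L) (a : VirtualAlloc M) (i : Fin M) : ℝ :=
  a.share (Sum.inl i) * Real.log (1 + eta s (Sum.inl i) * a.pow (Sum.inl i)) +
    a.share (Sum.inr i) * (1 / 2 * Real.log (1 + eta s (Sum.inr i) * a.pow (Sum.inr i)))

/-- The weighted sum rate of the block. -/
def objective (μ : Fin M → ℝ) (s : Fading M L) (a : VirtualAlloc M) : ℝ :=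
  ∑ j, a.share j * f μ s j (a.pow j)

open Classical in
/-- The access ratio and power of virtual user `j`, if it is given power. -/
def active (a : VirtualAlloc M) (j : VUser M) : Option (ℝ × ℝ) :=
  if 0 < a.share j ∧ 0 < a.pow j then some (a.share j, a.pow j) else none

/-- A measurable assignment of admissible allocations to fading states. -/
def IsPolicy (p : Fading M L → VirtualAlloc M) : Prop :=
  (∀ s : Fading M L, s.Positive → (p s).Admissible s) ∧
    ∀ j, Measurable (fun s => (p s).share j) ∧ Measurable (fun s => (p s).pow j)

/-- `a` solves the broadcast problem with virtual users for the realization `g` of the fading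
sequence. -/
def IsOptimal (μ : Fin M → ℝ) (Pbar : ℝ) (g : ℕ → Fading M L) (a : ℕ → VirtualAlloc M) : Prop :=
  IsOptimalSeq (fun k b => b.Admissible (g k)) power (fun k b => b.objective μ (g k)) Pbar a

/-- The achievable rates region of the broadcast channel with virtual users. -/
def region (Pbar : ℝ) (g : ℕ → Fading M L) : Set (Fin M → ℝ) :=
  rateRegion (fun k b => Admissible (g k) b) (power (M := M)) (fun k b => b.rate (g k)) Pbar

/-- The long-term weighted sum rates attained by feasible sequences of allocations. -/
def values (μ : Fin M → ℝ) (Pbar : ℝ) (g : ℕ → Fading M L) : Set EReal :=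
  {v | ∃ a : ℕ → VirtualAlloc M, IsFeasibleSeq (fun k b => b.Admissible (g k)) power Pbar a ∧
    v = longTermAvg fun k => (a k).objective μ (g k)}

end VirtualAlloc

/-- `A` carries out the virtual allocation `a` in the relay-assisted channel: the DT users keep
their ratios and powers, and every present DF user `i` uses a best relay of `i`, with its
power `P` split as `P_s = 2P / (1 + (γ'_sr - 1) / γ'_rd)` and `P_r = 2P - P_s`, where
`γ'_sr = γ_sr / γ_sd` and `γ'_rd = γ_rd / γ_sd`. -/
def Realizes (s : Fading M L) (a : VirtualAlloc M) (A : RelayAlloc M L) : Prop :=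
  A.Admissible ∧ ∀ i,
    A.shareDT i = a.share (Sum.inl i) ∧ A.powerDT i = a.pow (Sum.inl i) ∧
    A.shareDF i = a.share (Sum.inr i) ∧
    (Present s (Sum.inr i) →
      IsBestRelay s i (A.relay i) ∧
      A.powerS i = 2 * a.pow (Sum.inr i) /
        (1 + (s (Link.sr (A.relay i)) / s (Link.sd i) - 1) /
          (s (Link.rd (A.relay i) i) / s (Link.sd i))) ∧
      A.powerR i = 2 * a.pow (Sum.inr i) - A.powerS i)

/-! ## Scheduling and water-filling -/

/-- The water-filling power `[ω_j / price - 1 / η_j]^+` of virtual user `j`. -/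
def waterPower (μ : Fin M → ℝ) (price : ℝ) (s : Fading M L) (j : VUser M) : ℝ :=
  max (omega μ j / price - 1 / eta s j) 0

/-- `m` maximizes `f_j(P_j) - price * P_j` over the present virtual users, where `P_j` is the
water-filling power. -/
def IsScheduled (μ : Fin M → ℝ) (price : ℝ) (s : Fading M L) (m : VUser M) : Prop :=
  Present s m ∧ ∀ j, Present s j →
    f μ s j (waterPower μ price s j) - price * waterPower μ price s j ≤
      f μ s m (waterPower μ price s m) - price * waterPower μ price s m

/-- The whole block goes to a single virtual user, which maximizes `f_j(P_j) - price * P_j` and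
gets its water-filling power. -/
def IsWaterFilling (μ : Fin M → ℝ) (price : ℝ) (s : Fading M L) (a : VirtualAlloc M) : Prop :=
  a.Admissible s ∧ ∃ m, IsScheduled μ price s m ∧ a.share m = 1 ∧ (∀ l, l ≠ m → a.share l = 0) ∧
    a.pow m = waterPower μ price s m

end RelayBC

end

noncomputable section

namespace RelayBC

variable {M L : ℕ}

/-! ## Water-filling on a single logarithmic channel -/

/-! The proof is Lagrangian duality for the power constraint, on top of a reduction carried out in
each block separately.

Reduction: for a useful relay, the decode-and-forward rate at fixed total power is a minimum of two
hops, and the split that balances them is the unique optimum (`min_hop_le`). This gives a single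
logarithmic channel whose quality depends on the relay only through its gain. A relay that is not
useful does no better than direct transmission, because `1 + 2x ≤ (1 + x)^2`. Hence every relay
allocation has a virtual counterpart with exactly the same user rates and no more power
(`RelayAlloc.exists_virtualAlloc`), and every virtual allocation is realized with equality. All
claims comparing the two problems follow.

Duality: fix a price per unit of power. In one block, rate minus priced power averages, with the
ratios as weights, the net values of the users. It is therefore at most the net value of the
scheduled user, and equality forces each user with a positive ratio to be scheduled at its
water-filling power (`VirtualAlloc.objective_le`, `VirtualAlloc.scheduled_of_objective_eq`, and
their relay analogues). Averaged over the blocks, this bounds every feasible sequence, and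
water-filling attains the bound once its mean power equals the budget.

Choice of the price: the mean scheduled power is continuous in the price since ties at positive
power have probability zero (`ae_generic`), it is at most the budget at one price, and it exceeds
every bound as the price tends to zero. The intermediate value theorem applies (`exists_price`).

Randomness: the strong law turns block averages into means. For an optimal stationary policy it
shows that the expected loss against the dual bound is zero, so the loss vanishes in almost every
state, and the equality case identifies the policy (`IsIIDFading.ae_eq_of_le_longTermAvg`,
`VirtualAlloc.active_eq`, `RelayAlloc.active_eq`). -/

/-- The power maximizing `w * log (1 + η * P) - price * P` over `P ≥ 0`. -/
def optPower (w η price : ℝ) : ℝ := max (w / price - 1 / η) 0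

/-- Weighted rate minus the cost of the power. -/
def netValue (w η price P : ℝ) : ℝ := w * Real.log (1 + η * P) - price * P

/-- The largest net value over all powers. -/
def optValue (w η price : ℝ) : ℝ := netValue w η price (optPower w η price)

lemma optPower_nonneg (w η price : ℝ) : 0 ≤ optPower w η price := le_max_right _ _

lemma optPower_zero_left {η price : ℝ} (hη : 0 < η) : optPower 0 η price = 0 := by
  have : 0 < 1 / η := by positivity
  simp only [optPower, zero_div, zero_sub]
  exact max_eq_right (by linarith)

lemma optPower_le {w η price : ℝ} (hw : 0 ≤ w) (hη : 0 < η) (hp : 0 < price) :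
    optPower w η price ≤ w / price := by
  have : 0 < 1 / η := by positivity
  have : 0 ≤ w / price := by positivity
  exact max_le (by linarith) this

lemma netValue_zero (w η price : ℝ) : netValue w η price 0 = 0 := by simp [netValue]

/-- The logarithm lies strictly below its tangent at the water-filling power, and the slope of that
tangent, times the weight, equals the price when the power is positive and is at most the price when
it is zero. Weight zero is treated apart, since then only the cost of power makes the inequality
strict. -/
lemma netValue_lt_optValue {w η price P : ℝ} (hw : 0 ≤ w) (hη : 0 < η) (hp : 0 < price)
    (hP : 0 ≤ P) (hne : P ≠ optPower w η price) : netValue w η price P < optValue w η price := by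
  rcases hw.eq_or_lt with rfl | hw
  · rw [optPower_zero_left hη] at hne
    have : 0 < P := lt_of_le_of_ne hP (Ne.symm hne)
    simp only [optValue, optPower_zero_left hη, netValue, zero_mul, zero_sub]
    nlinarith
  set Q := optPower w η price with hQ
  have hQ0 : 0 ≤ Q := optPower_nonneg _ _ _
  have h1 : 0 < 1 + η * P := by positivity
  have h2 : 0 < 1 + η * Q := by positivity
  have hlog : Real.log (1 + η * P) - Real.log (1 + η * Q) < η * (P - Q) / (1 + η * Q) := by
    rw [← Real.log_div h1.ne' h2.ne']
    have hx : (1 + η * P) / (1 + η * Q) ≠ 1 := by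
      rw [Ne, div_eq_one_iff_eq h2.ne']
      intro h
      exact hne (mul_left_cancel₀ hη.ne' (by linarith))
    have := Real.log_lt_sub_one_of_pos (div_pos h1 h2) hx
    have e : (1 + η * P) / (1 + η * Q) - 1 = η * (P - Q) / (1 + η * Q) := by
      field_simp; ring
    linarith
  -- The first-order optimality condition: complementary slackness splits it into `Q = 0` and `1 + η
  -- * Q = w * η / price`.
  have hslope : w * (η * (P - Q) / (1 + η * Q)) ≤ price * (P - Q) := by
    rcases le_or_gt (w / price - 1 / η) 0 with h | h
    · have hQ' : Q = 0 := max_eq_right h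
      rw [hQ']
      have : w / price ≤ 1 / η := by linarith
      rw [div_le_div_iff₀ hp hη] at this
      simp only [sub_zero, mul_zero, add_zero, div_one]
      nlinarith
    · have hQ' : Q = w / price - 1 / η := max_eq_left h.le
      have : 1 + η * Q = w * η / price := by
        rw [hQ']; field_simp; ring
      rw [this]
      apply le_of_eq
      field_simp
  have := mul_lt_mul_of_pos_left hlog hw
  change netValue w η price P < netValue w η price Q
  simp only [netValue]
  linarith

lemma netValue_le_optValue {w η price P : ℝ} (hw : 0 ≤ w) (hη : 0 < η) (hp : 0 < price)
    (hP : 0 ≤ P) : netValue w η price P ≤ optValue w η price := by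
  by_cases h : P = optPower w η price
  · rw [h, optValue]
  · exact (netValue_lt_optValue hw hη hp hP h).le

lemma optValue_nonneg {w η price : ℝ} (hw : 0 ≤ w) (hη : 0 < η) (hp : 0 < price) :
    0 ≤ optValue w η price := by
  simpa [netValue_zero] using netValue_le_optValue hw hη hp le_rfl

/-- Compare with power zero, where strictness applies. Because of this equivalence, ties matter only
at positive values. -/
lemma optValue_pos_iff {w η price : ℝ} (hw : 0 ≤ w) (hη : 0 < η) (hp : 0 < price) :
    0 < optValue w η price ↔ 0 < optPower w η price := by
  constructor
  · intro h
    rcases (optPower_nonneg w η price).eq_or_lt with h0 | h0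
    · rw [optValue, ← h0, netValue_zero] at h
      exact absurd h (lt_irrefl _)
    · exact h0
  · intro h
    simpa [netValue_zero] using netValue_lt_optValue hw hη hp le_rfl h.ne

/-- Keep the power that is optimal for `η` and improve the channel. A positive value forces positive
weight and positive power, so the gain is strict. -/
lemma optValue_lt_optValue {w η η' price : ℝ} (hw : 0 ≤ w) (hη : 0 < η) (hp : 0 < price)
    (hlt : η < η') (hpos : 0 < optValue w η price) :
    optValue w η price < optValue w η' price := by
  have hP := (optValue_pos_iff hw hη hp).1 hpos
  have hw' : 0 < w := by
    rcases hw.eq_or_lt with rfl | h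
    · rw [optPower_zero_left hη] at hP; exact absurd hP (lt_irrefl _)
    · exact h
  refine lt_of_lt_of_le ?_ (netValue_le_optValue hw (hη.trans hlt) hp hP.le)
  have : Real.log (1 + η * optPower w η price) < Real.log (1 + η' * optPower w η price) := by
    apply Real.log_lt_log (by positivity)
    nlinarith
  simp only [optValue, netValue]
  nlinarith

lemma eq_of_optValue_eq {w η η' price v : ℝ} (hw : 0 ≤ w) (hη : 0 < η) (hη' : 0 < η')
    (hp : 0 < price) (hv : 0 < v) (h : optValue w η price = v) (h' : optValue w η' price = v) :
    η = η' := by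
  rcases lt_trichotomy η η' with hl | hl | hl
  · have := optValue_lt_optValue hw hη hp hl (h ▸ hv); linarith
  · exact hl
  · have := optValue_lt_optValue hw hη' hp hl (h' ▸ hv); linarith

/-- Solving for the power allows rates to be matched exactly rather than merely dominated, as
equality of the rate regions requires. -/
lemma exists_power_log_eq {η P r : ℝ} (hη : 0 < η) (hP : 0 ≤ P) (hr : 0 ≤ r)
    (hle : r ≤ Real.log (1 + η * P)) : ∃ Q, 0 ≤ Q ∧ Q ≤ P ∧ Real.log (1 + η * Q) = r := by
  have h1 : 0 < 1 + η * P := by positivity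
  have hexp : Real.exp r ≤ 1 + η * P := (Real.le_log_iff_exp_le h1).1 hle
  have hexp1 : 1 ≤ Real.exp r := Real.one_le_exp hr
  refine ⟨(Real.exp r - 1) / η, div_nonneg (by linarith) hη.le, ?_, ?_⟩
  · rw [div_le_iff₀ hη]; linarith
  · rw [mul_div_cancel₀ _ hη.ne', add_sub_cancel, Real.log_exp]

lemma half_log_one_add_two_mul_le {x : ℝ} (hx : 0 ≤ x) :
    1 / 2 * Real.log (1 + 2 * x) ≤ Real.log (1 + x) := by
  have : Real.log (1 + 2 * x) ≤ Real.log ((1 + x) ^ 2) :=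
    Real.log_le_log (by positivity) (by nlinarith)
  rw [Real.log_pow] at this
  push_cast at this
  linarith

lemma half_log_one_add_two_mul_lt {x : ℝ} (hx : 0 < x) :
    1 / 2 * Real.log (1 + 2 * x) < Real.log (1 + x) := by
  have : Real.log (1 + 2 * x) < Real.log ((1 + x) ^ 2) :=
    Real.log_lt_log (by positivity) (by nlinarith)
  rw [Real.log_pow] at this
  push_cast at this
  linarith

/-- Concavity in tangent form. With `Q` a weighted mean of powers, the linear terms cancel and
Jensen's inequality results. -/
lemma log_one_add_mul_tangent {η P Q : ℝ} (hη : 0 < η) (hP : 0 ≤ P) (hQ : 0 ≤ Q) :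
    Real.log (1 + η * P) ≤ Real.log (1 + η * Q) + η * (P - Q) / (1 + η * Q) := by
  have h1 : 0 < 1 + η * P := by positivity
  have h2 : 0 < 1 + η * Q := by positivity
  have := Real.log_le_sub_one_of_pos (div_pos h1 h2)
  rw [Real.log_div h1.ne' h2.ne'] at this
  have e : (1 + η * P) / (1 + η * Q) - 1 = η * (P - Q) / (1 + η * Q) := by
    field_simp; ring
  linarith

/-! ## Relay selection -/

/-- Clears the normalization by the direct gain. No usefulness is needed: when the denominator
vanishes both sides are zero by the convention for division. -/
lemma gain_eq {s : Fading M L} (hs : s.Positive) (i : Fin M) (l : Fin L) :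
    s (Link.sd i) * gain s i l =
      s (Link.sr l) * s (Link.rd l i) / (s (Link.sr l) + s (Link.rd l i) - s (Link.sd i)) := by
  have hg := hs (Link.sd i)
  have : s (Link.sr l) / s (Link.sd i) + s (Link.rd l i) / s (Link.sd i) - 1 =
      (s (Link.sr l) + s (Link.rd l i) - s (Link.sd i)) / s (Link.sd i) := by
    field_simp
  rw [gain, this]
  by_cases h : s (Link.sr l) + s (Link.rd l i) - s (Link.sd i) = 0
  · simp [h]
  · field_simp

lemma useful_iff {s : Fading M L} (hs : s.Positive) (i : Fin M) (l : Fin L) :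
    Useful s i l ↔ s (Link.sd i) < s (Link.sr l) ∧ s (Link.sd i) < s (Link.rd l i) := by
  rw [Useful, one_lt_div (hs _), one_lt_div (hs _)]

/-- For normalized gains `x, y > 1` this is `(x - 1) * (y - 1) > 0`. -/
lemma one_lt_gain {s : Fading M L} {i : Fin M} {l : Fin L} (h : Useful s i l) :
    1 < gain s i l := by
  obtain ⟨hx, hy⟩ := h
  rw [gain, one_lt_div (by linarith)]
  nlinarith

/-- Keeps the relay–user links out of the rate bounds, so that no integrability is needed for them.
-/
lemma mul_gain_le {s : Fading M L} (hs : s.Positive) {i : Fin M} {l : Fin L}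
    (h : Useful s i l) : s (Link.sd i) * gain s i l ≤ s (Link.sr l) := by
  rw [useful_iff hs] at h
  have hr := hs (Link.sr l)
  rw [gain_eq hs, div_le_iff₀ (by linarith [hs (Link.rd l i)])]
  nlinarith

lemma exists_isBestRelay {s : Fading M L} {i : Fin M} (h : ∃ l, Useful s i l) :
    ∃ l, IsBestRelay s i l := by
  classical
  obtain ⟨l₀, h₀⟩ := h
  obtain ⟨l, hl, hmax⟩ := Finset.exists_max_image (Finset.univ.filter fun l => Useful s i l)
    (gain s i) ⟨l₀, by simpa using h₀⟩
  exact ⟨l, by simpa using hl, fun l' hl' => hmax l' (by simpa using hl')⟩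

lemma IsBestRelay.bestGain_eq {s : Fading M L} {i : Fin M} {l : Fin L} (h : IsBestRelay s i l) :
    bestGain s i = gain s i l := by
  apply IsGreatest.csSup_eq
  exact ⟨⟨l, h.1, rfl⟩, by rintro _ ⟨l', hl', rfl⟩; exact h.2 l' hl'⟩

lemma IsBestRelay.eta_eq {s : Fading M L} {i : Fin M} {l : Fin L} (h : IsBestRelay s i l) :
    eta s (Sum.inr i) = 2 * s (Link.sd i) * gain s i l := by
  rw [eta, h.bestGain_eq]

lemma gain_le_bestGain {s : Fading M L} {i : Fin M} {l : Fin L} (h : Useful s i l) :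
    gain s i l ≤ bestGain s i := by
  obtain ⟨l', hl'⟩ := exists_isBestRelay ⟨l, h⟩
  rw [hl'.bestGain_eq]
  exact hl'.2 l h

lemma eta_pos {s : Fading M L} (hs : s.Positive) {j : VUser M} (hj : Present s j) :
    0 < eta s j := by
  rcases j with i | i
  · exact hs _
  · obtain ⟨l, hl⟩ := exists_isBestRelay hj
    rw [hl.eta_eq]
    have := one_lt_gain hl.1
    have := hs (Link.sd i)
    positivity

lemma omega_nonneg {μ : Fin M → ℝ} (hμ : ∀ i, 0 ≤ μ i) (j : VUser M) : 0 ≤ omega μ j := by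
  rcases j with i | i
  · exact hμ i
  · exact div_nonneg (hμ i) (by norm_num)

/-! ## The decode-and-forward link -/

lemma RelayAlloc.rateDT_nonneg {s : Fading M L} (hs : s.Positive) {A : RelayAlloc M L}
    (hA : A.Admissible) (i : Fin M) : 0 ≤ A.rateDT s i := by
  obtain ⟨-, -, hP, -, -⟩ := hA.1 i
  have := hs (Link.sd i)
  exact Real.log_nonneg (by nlinarith [mul_nonneg this.le hP])

lemma RelayAlloc.rateDF_nonneg {s : Fading M L} (hs : s.Positive) {A : RelayAlloc M L}
    (hA : A.Admissible) (i : Fin M) : 0 ≤ A.rateDF s i := by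
  obtain ⟨-, -, -, hS, hR⟩ := hA.1 i
  have h1 := mul_nonneg (hs (Link.sd i)).le hS
  have h2 := mul_nonneg (hs (Link.sr (A.relay i))).le hS
  have h3 := mul_nonneg (hs (Link.rd (A.relay i) i)).le hR
  exact le_min (mul_nonneg (by norm_num) (Real.log_nonneg (by linarith)))
    (mul_nonneg (by norm_num) (Real.log_nonneg (by linarith)))

lemma RelayAlloc.rate_nonneg {s : Fading M L} (hs : s.Positive) {A : RelayAlloc M L}
    (hA : A.Admissible) (i : Fin M) : 0 ≤ A.rate s i := by
  have h1 := rateDF_nonneg hs hA i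
  have h2 := rateDT_nonneg hs hA i
  obtain ⟨h3, h4, -⟩ := hA.1 i
  exact add_nonneg (mul_nonneg h4 h1) (mul_nonneg h3 h2)

/-- The source power of the decode-and-forward link through relay `l` that makes both hops
equally good when the total energy is `2 * P`. -/
def splitPower (s : Fading M L) (i : Fin M) (l : Fin L) (P : ℝ) : ℝ :=
  2 * P / (1 + (s (Link.sr l) / s (Link.sd i) - 1) / (s (Link.rd l i) / s (Link.sd i)))

lemma splitPower_eq {s : Fading M L} (hs : s.Positive) {i : Fin M} {l : Fin L}
    (h : Useful s i l) (P : ℝ) : splitPower s i l P =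
      2 * P * s (Link.rd l i) / (s (Link.sr l) + s (Link.rd l i) - s (Link.sd i)) := by
  rw [useful_iff hs] at h
  have hg := hs (Link.sd i)
  have hy := hs (Link.rd l i)
  have hd : 0 < s (Link.sr l) + s (Link.rd l i) - s (Link.sd i) := by linarith
  have : 1 + (s (Link.sr l) / s (Link.sd i) - 1) / (s (Link.rd l i) / s (Link.sd i)) =
      (s (Link.sr l) + s (Link.rd l i) - s (Link.sd i)) / s (Link.rd l i) := by
    field_simp; ring
  rw [splitPower, this]
  field_simp

lemma splitPower_nonneg {s : Fading M L} (hs : s.Positive) {i : Fin M} {l : Fin L}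
    (h : Useful s i l) {P : ℝ} (hP : 0 ≤ P) : 0 ≤ splitPower s i l P := by
  rw [splitPower_eq hs h]
  rw [useful_iff hs] at h
  have hy := hs (Link.rd l i)
  exact div_nonneg (by positivity) (by linarith)

lemma splitPower_le {s : Fading M L} (hs : s.Positive) {i : Fin M} {l : Fin L}
    (h : Useful s i l) {P : ℝ} (hP : 0 ≤ P) : splitPower s i l P ≤ 2 * P := by
  rw [splitPower_eq hs h]
  rw [useful_iff hs] at h
  have hy := hs (Link.rd l i)
  rw [div_le_iff₀ (by linarith)]
  nlinarith

lemma sr_mul_splitPower {s : Fading M L} (hs : s.Positive) {i : Fin M} {l : Fin L}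
    (h : Useful s i l) (P : ℝ) :
    s (Link.sr l) * splitPower s i l P = 2 * s (Link.sd i) * gain s i l * P := by
  rw [splitPower_eq hs h]
  have := gain_eq hs i l
  linear_combination (-2 * P) * this

lemma sd_add_rd_splitPower {s : Fading M L} (hs : s.Positive) {i : Fin M} {l : Fin L}
    (h : Useful s i l) (P : ℝ) :
    s (Link.sd i) * splitPower s i l P + s (Link.rd l i) * (2 * P - splitPower s i l P) =
      2 * s (Link.sd i) * gain s i l * P := by
  have h0 := h
  rw [useful_iff hs] at h0
  have hd : s (Link.sr l) + s (Link.rd l i) - s (Link.sd i) ≠ 0 := by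
    have := hs (Link.rd l i)
    linarith
  rw [← sr_mul_splitPower hs h, splitPower_eq hs h]
  field_simp
  ring

/-- With useful relay `l`, the rate of decode-and-forward is largest at the balanced split. -/
lemma min_hop_le {s : Fading M L} (hs : s.Positive) {i : Fin M} {l : Fin L}
    (h : Useful s i l) (S R : ℝ) :
    min (s (Link.sr l) * S) (s (Link.sd i) * S + s (Link.rd l i) * R) ≤
      2 * s (Link.sd i) * gain s i l * ((S + R) / 2) ∧
    (min (s (Link.sr l) * S) (s (Link.sd i) * S + s (Link.rd l i) * R) =
      2 * s (Link.sd i) * gain s i l * ((S + R) / 2) → S = splitPower s i l ((S + R) / 2)) := by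
  have hx := hs (Link.sr l)
  have h1 := sr_mul_splitPower hs h ((S + R) / 2)
  have h2 := sd_add_rd_splitPower hs h ((S + R) / 2)
  rw [useful_iff hs] at h
  set T := splitPower s i l ((S + R) / 2)
  -- Below the balanced source power the first hop is strictly worse. Above it the second hop is
  -- strictly worse, since the relay–user gain exceeds the direct gain and power has been moved away
  -- from the relay.
  rcases lt_trichotomy S T with hl | hl | hl
  · have : s (Link.sr l) * S < 2 * s (Link.sd i) * gain s i l * ((S + R) / 2) := by
      rw [← h1]; exact mul_lt_mul_of_pos_left hl hx
    have := (min_le_left _ (s (Link.sd i) * S + s (Link.rd l i) * R)).trans_lt this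
    exact ⟨this.le, fun h => absurd h this.ne⟩
  · refine ⟨?_, fun _ => hl⟩
    rw [← h1, hl]; exact min_le_left _ _
  · have : s (Link.sd i) * S + s (Link.rd l i) * R <
        2 * s (Link.sd i) * gain s i l * ((S + R) / 2) := by
      rw [← h2]; nlinarith [mul_pos (sub_pos.2 h.2) (sub_pos.2 hl)]
    have := (min_le_right (s (Link.sr l) * S) _).trans_lt this
    exact ⟨this.le, fun h => absurd h this.ne⟩

/-- Monotonicity of the logarithm moves the minimum inside, where the two hops are linear in the
powers. -/
lemma RelayAlloc.rateDF_eq {s : Fading M L} (hs : s.Positive) {A : RelayAlloc M L}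
    (hA : A.Admissible) (i : Fin M) : A.rateDF s i = 1 / 2 * Real.log
      (1 + min (s (Link.sr (A.relay i)) * A.powerS i)
        (s (Link.sd i) * A.powerS i + s (Link.rd (A.relay i) i) * A.powerR i)) := by
  obtain ⟨-, -, -, hS, hR⟩ := hA.1 i
  have h1 := mul_nonneg (hs (Link.sd i)).le hS
  have h2 := mul_nonneg (hs (Link.sr (A.relay i))).le hS
  have h3 := mul_nonneg (hs (Link.rd (A.relay i) i)).le hR
  rw [rateDF, add_assoc]
  rcases le_total (s (Link.sr (A.relay i)) * A.powerS i)
    (s (Link.sd i) * A.powerS i + s (Link.rd (A.relay i) i) * A.powerR i) with h | h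
  · rw [min_eq_left h, min_eq_left]
    have := Real.log_le_log (x := 1 + s (Link.sr (A.relay i)) * A.powerS i) (by linarith)
      (add_le_add_right h 1)
    linarith
  · rw [min_eq_right h, min_eq_right]
    have := Real.log_le_log
      (x := 1 + (s (Link.sd i) * A.powerS i + s (Link.rd (A.relay i) i) * A.powerR i))
      (by linarith) (add_le_add_right h 1)
    linarith

/-- Mean power of the decode-and-forward link. -/
def RelayAlloc.powerDF (A : RelayAlloc M L) (i : Fin M) : ℝ := A.powerS i / 2 + A.powerR i / 2

lemma RelayAlloc.Admissible.powerDF_nonneg {A : RelayAlloc M L} (hA : A.Admissible)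
    (i : Fin M) : 0 ≤ A.powerDF i := by
  obtain ⟨-, -, -, hS, hR⟩ := hA.1 i
  exact add_nonneg (by linarith) (by linarith)

lemma RelayAlloc.min_hop_nonneg {s : Fading M L} (hs : s.Positive) {A : RelayAlloc M L}
    (hA : A.Admissible) (i : Fin M) : 0 ≤ min (s (Link.sr (A.relay i)) * A.powerS i)
        (s (Link.sd i) * A.powerS i + s (Link.rd (A.relay i) i) * A.powerR i) := by
  obtain ⟨-, -, -, hS, hR⟩ := hA.1 i
  have h1 := mul_nonneg (hs (Link.sd i)).le hS
  have h2 := mul_nonneg (hs (Link.sr (A.relay i))).le hS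
  have h3 := mul_nonneg (hs (Link.rd (A.relay i) i)).le hR
  exact le_min h2 (by linarith)

/-- One of the two hops out of or into the relay has a gain at most the direct one. The hop term
containing it is then at most the direct gain times the total power of the two sub-slots. -/
lemma RelayAlloc.rateDF_le_of_not_useful {s : Fading M L} (hs : s.Positive)
    {A : RelayAlloc M L} (hA : A.Admissible) {i : Fin M} (hu : ¬ Useful s i (A.relay i)) :
    A.rateDF s i ≤ 1 / 2 * Real.log (1 + 2 * (s (Link.sd i) * A.powerDF i)) := by
  have h0 := min_hop_nonneg hs hA i
  rw [rateDF_eq hs hA]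
  obtain ⟨-, -, -, hS, hR⟩ := hA.1 i
  have hg := hs (Link.sd i)
  refine mul_le_mul_of_nonneg_left (Real.log_le_log (by linarith) ?_) (by norm_num)
  rw [useful_iff hs, not_and_or, not_lt, not_lt] at hu
  have e : 2 * (s (Link.sd i) * A.powerDF i) = s (Link.sd i) * (A.powerS i + A.powerR i) := by
    rw [powerDF]; ring
  rw [e]
  refine add_le_add_right ?_ 1
  rcases hu with hu | hu
  · refine (min_le_left _ _).trans ?_
    nlinarith [mul_le_mul_of_nonneg_right hu hS, mul_nonneg hg.le hR]
  · refine (min_le_right _ _).trans ?_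
    nlinarith [mul_le_mul_of_nonneg_right hu hR]

lemma RelayAlloc.rateDF_le_of_useful {s : Fading M L} (hs : s.Positive)
    {A : RelayAlloc M L} (hA : A.Admissible) {i : Fin M} (hu : Useful s i (A.relay i)) :
    A.rateDF s i ≤
      1 / 2 * Real.log (1 + 2 * s (Link.sd i) * gain s i (A.relay i) * A.powerDF i) := by
  have h0 := min_hop_nonneg hs hA i
  rw [rateDF_eq hs hA]
  refine mul_le_mul_of_nonneg_left (Real.log_le_log (by linarith) ?_) (by norm_num)
  have := (min_hop_le hs hu (A.powerS i) (A.powerR i)).1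
  rw [powerDF, ← add_div]
  linarith

/-- A useful relay has gain at most the best one, and a relay that is not useful behaves at most
like gain one, which is below the best one. -/
lemma RelayAlloc.rateDF_le_of_present {s : Fading M L} (hs : s.Positive)
    {A : RelayAlloc M L} (hA : A.Admissible) {i : Fin M} (hi : Present s (Sum.inr i)) :
    A.rateDF s i ≤ 1 / 2 * Real.log (1 + eta s (Sum.inr i) * A.powerDF i) := by
  have hP := hA.powerDF_nonneg i
  have hg := hs (Link.sd i)
  by_cases hu : Useful s i (A.relay i)
  · refine (rateDF_le_of_useful hs hA hu).trans ?_
    have h1 := one_lt_gain hu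
    refine mul_le_mul_of_nonneg_left (Real.log_le_log (by positivity) ?_) (by norm_num)
    have := gain_le_bestGain hu
    rw [eta]
    gcongr
  · refine (rateDF_le_of_not_useful hs hA hu).trans ?_
    refine mul_le_mul_of_nonneg_left (Real.log_le_log (by positivity) ?_) (by norm_num)
    obtain ⟨l, hl⟩ := exists_isBestRelay hi
    have h1 := one_lt_gain hl.1
    rw [hl.eta_eq]
    have : s (Link.sd i) * A.powerDF i * 1 ≤ s (Link.sd i) * A.powerDF i * gain s i l :=
      mul_le_mul_of_nonneg_left h1.le (by positivity)
    linarith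

/-! ## Equivalence of the two problems, block by block -/

lemma RelayAlloc.power_eq (A : RelayAlloc M L) :
    A.power = ∑ i, (A.shareDT i * A.powerDT i + A.shareDF i * A.powerDF i) := rfl

lemma VirtualAlloc.power_eq (a : VirtualAlloc M) :
    a.power = ∑ i, (a.share (Sum.inl i) * a.pow (Sum.inl i) +
      a.share (Sum.inr i) * a.pow (Sum.inr i)) := by
  rw [power, Fintype.sum_sum_type, Finset.sum_add_distrib]

lemma VirtualAlloc.objective_eq (μ : Fin M → ℝ) (s : Fading M L) (a : VirtualAlloc M) :
    a.objective μ s = ∑ i, μ i * a.rate s i := by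
  rw [objective, Fintype.sum_sum_type, ← Finset.sum_add_distrib]
  refine Finset.sum_congr rfl fun i _ => ?_
  simp only [f, omega, rate]
  ring

lemma VirtualAlloc.Admissible.sum_eq {s : Fading M L} {a : VirtualAlloc M}
    (ha : a.Admissible s) : ∑ i, (a.share (Sum.inl i) + a.share (Sum.inr i)) = 1 := by
  rw [← ha.2.1, Fintype.sum_sum_type, Finset.sum_add_distrib]

open Classical in
/-- The relay allocation carrying out a virtual allocation with the given relays. -/
def VirtualAlloc.toRelay (s : Fading M L) (a : VirtualAlloc M) (r : Fin M → Fin L) :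
    RelayAlloc M L where
  shareDT i := a.share (Sum.inl i)
  shareDF i := a.share (Sum.inr i)
  relay := r
  powerDT i := a.pow (Sum.inl i)
  powerS i := if Present s (Sum.inr i) then splitPower s i (r i) (a.pow (Sum.inr i)) else 0
  powerR i := if Present s (Sum.inr i) then
    2 * a.pow (Sum.inr i) - splitPower s i (r i) (a.pow (Sum.inr i)) else 0

lemma VirtualAlloc.realizes_toRelay {s : Fading M L} (hs : s.Positive) {a : VirtualAlloc M}
    (ha : a.Admissible s) {r : Fin M → Fin L}
    (hr : ∀ i, Present s (Sum.inr i) → IsBestRelay s i (r i)) : Realizes s a (a.toRelay s r) := by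
  refine ⟨⟨fun i => ⟨(ha.1 _).1, (ha.1 _).1, (ha.1 _).2, ?_, ?_⟩, ha.sum_eq⟩,
    fun i => ⟨rfl, rfl, rfl, fun hi => ⟨hr i hi, ?_, ?_⟩⟩⟩
  · by_cases hi : Present s (Sum.inr i)
    · simp only [toRelay, if_pos hi]
      exact splitPower_nonneg hs (hr i hi).1 (ha.1 _).2
    · simp [toRelay, if_neg hi]
  · by_cases hi : Present s (Sum.inr i)
    · simp only [toRelay, if_pos hi]
      exact sub_nonneg.2 (splitPower_le hs (hr i hi).1 (ha.1 _).2)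
    · simp [toRelay, if_neg hi]
  · simp only [toRelay, if_pos hi, splitPower]
  · simp only [toRelay, if_pos hi]

lemma exists_realizes (hL : 0 < L) {s : Fading M L} (hs : s.Positive) {a : VirtualAlloc M}
    (ha : a.Admissible s) : ∃ A : RelayAlloc M L, Realizes s a A := by
  have : ∀ i, ∃ l, Present s (Sum.inr i) → IsBestRelay s i l := by
    intro i
    by_cases hi : Present s (Sum.inr i)
    · obtain ⟨l, hl⟩ := exists_isBestRelay hi
      exact ⟨l, fun _ => hl⟩
    · exact ⟨⟨0, hL⟩, fun h => absurd h hi⟩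
  choose r hr using this
  exact ⟨_, VirtualAlloc.realizes_toRelay hs ha hr⟩

lemma Realizes.power_eq {s : Fading M L} {a : VirtualAlloc M} {A : RelayAlloc M L}
    (ha : a.Admissible s) (h : Realizes s a A) : A.power = a.power := by
  rw [RelayAlloc.power_eq, VirtualAlloc.power_eq]
  refine Finset.sum_congr rfl fun i _ => ?_
  obtain ⟨h1, h2, h3, h4⟩ := h.2 i
  rw [h1, h2, h3]
  by_cases hi : Present s (Sum.inr i)
  · obtain ⟨-, -, h6⟩ := h4 hi
    rw [RelayAlloc.powerDF, h6]; ring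
  · simp [ha.2.2 _ hi]

/-- The split balances the hops, so the minimum is over two equal terms. An absent DF user has ratio
zero, so its unconstrained relay and powers do not matter. -/
lemma Realizes.rate_eq {s : Fading M L} (hs : s.Positive) {a : VirtualAlloc M}
    {A : RelayAlloc M L} (ha : a.Admissible s) (h : Realizes s a A) (i : Fin M) :
    A.rate s i = a.rate s i := by
  obtain ⟨h1, h2, h3, h4⟩ := h.2 i
  rw [RelayAlloc.rate, VirtualAlloc.rate, RelayAlloc.rateDT, h1, h2, h3, add_comm]
  refine congrArg₂ _ rfl ?_
  by_cases hi : Present s (Sum.inr i)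
  · obtain ⟨h5, h6, h7⟩ := h4 hi
    have hS : A.powerS i = splitPower s i (A.relay i) (a.pow (Sum.inr i)) := h6
    rw [RelayAlloc.rateDF_eq hs h.1, h7, hS, sr_mul_splitPower hs h5.1,
      sd_add_rd_splitPower hs h5.1, min_self, h5.eta_eq]
  · simp [ha.2.2 _ hi]

lemma Realizes.objective_eq {s : Fading M L} (hs : s.Positive) {a : VirtualAlloc M}
    {A : RelayAlloc M L} (ha : a.Admissible s) (h : Realizes s a A) (μ : Fin M → ℝ) :
    A.objective μ s = a.objective μ s := by
  rw [VirtualAlloc.objective_eq, RelayAlloc.objective]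
  exact Finset.sum_congr rfl fun i _ => by rw [h.rate_eq hs ha]

/-- Time sharing on a direct link with a half-rate link of the same gain is no better than the
direct link alone. -/
lemma exists_merged_power {g t₁ t₂ P₁ P₂ r : ℝ} (hg : 0 < g) (ht₁ : 0 ≤ t₁) (ht₂ : 0 ≤ t₂)
    (hP₁ : 0 ≤ P₁) (hP₂ : 0 ≤ P₂) (hr : 0 ≤ r)
    (hle : r ≤ t₁ * Real.log (1 + g * P₁) + t₂ * Real.log (1 + g * P₂)) :
    ∃ Q, 0 ≤ Q ∧ (t₁ + t₂) * Q ≤ t₁ * P₁ + t₂ * P₂ ∧ (t₁ + t₂) * Real.log (1 + g * Q) = r := by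
  rcases (add_nonneg ht₁ ht₂).eq_or_lt with h0 | h0
  · have h1 : t₁ = 0 := by linarith
    have h2 : t₂ = 0 := by linarith
    subst h1 h2
    exact ⟨0, le_rfl, by simp, by simp at hle ⊢; linarith⟩
  · set Q := (t₁ * P₁ + t₂ * P₂) / (t₁ + t₂) with hQ
    have hQ0 : 0 ≤ Q := by positivity
    have hQe : (t₁ + t₂) * Q = t₁ * P₁ + t₂ * P₂ := mul_div_cancel₀ _ h0.ne'
    have hle' : r / (t₁ + t₂) ≤ Real.log (1 + g * Q) := by
      rw [div_le_iff₀ h0]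
      have a1 := mul_le_mul_of_nonneg_left (log_one_add_mul_tangent hg hP₁ hQ0) ht₁
      have a2 := mul_le_mul_of_nonneg_left (log_one_add_mul_tangent hg hP₂ hQ0) ht₂
      -- `Q` is the time-weighted mean power, so the first-order terms cancel.
      have e : t₁ * (g * (P₁ - Q) / (1 + g * Q)) + t₂ * (g * (P₂ - Q) / (1 + g * Q)) = 0 := by
        have : t₁ * (g * (P₁ - Q) / (1 + g * Q)) + t₂ * (g * (P₂ - Q) / (1 + g * Q)) =
          g * (t₁ * P₁ + t₂ * P₂ - (t₁ + t₂) * Q) / (1 + g * Q) := by ring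
        rw [this, hQe]; simp
      nlinarith
    obtain ⟨R, hR0, hRQ, hR⟩ := exists_power_log_eq hg hQ0 (by positivity) hle'
    refine ⟨R, hR0, ?_, ?_⟩
    · rw [← hQe]; exact mul_le_mul_of_nonneg_left hRQ h0.le
    · rw [hR, mul_div_cancel₀ _ h0.ne']

/-- If the user has a useful relay, keep the ratios and lower the DF power until the virtual rate
matches. Otherwise the DF link is dominated by the direct link, so its time is merged into the
direct one and the power is again lowered to match. -/
lemma RelayAlloc.exists_virtual_user {s : Fading M L} (hs : s.Positive)
    {A : RelayAlloc M L} (hA : A.Admissible) (i : Fin M) :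
    ∃ t₁ P₁ t₂ P₂ : ℝ, 0 ≤ t₁ ∧ 0 ≤ P₁ ∧ 0 ≤ t₂ ∧ 0 ≤ P₂ ∧
      t₁ + t₂ = A.shareDT i + A.shareDF i ∧ (¬ Present s (Sum.inr i) → t₂ = 0) ∧
      t₁ * P₁ + t₂ * P₂ ≤ A.shareDT i * A.powerDT i + A.shareDF i * A.powerDF i ∧
      t₁ * Real.log (1 + eta s (Sum.inl i) * P₁) +
        t₂ * (1 / 2 * Real.log (1 + eta s (Sum.inr i) * P₂)) = A.rate s i := by
  obtain ⟨h1, h2, h3, -, -⟩ := hA.1 i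
  have hP := hA.powerDF_nonneg i
  have hDF := rateDF_nonneg hs hA i
  by_cases hi : Present s (Sum.inr i)
  · have hle := rateDF_le_of_present hs hA hi
    obtain ⟨Q, hQ0, hQ, hQr⟩ := exists_power_log_eq (eta_pos hs hi) hP
      (mul_nonneg (by norm_num : (0 : ℝ) ≤ 2) hDF) (by linarith)
    refine ⟨A.shareDT i, A.powerDT i, A.shareDF i, Q, h1, h3, h2, hQ0, rfl,
      fun h => absurd hi h, ?_, ?_⟩
    · have := mul_le_mul_of_nonneg_left hQ h2
      linarith
    · rw [hQr, rate, rateDT, eta]; ring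
  · have hu : ¬ Useful s i (A.relay i) := fun h => hi ⟨_, h⟩
    have hg := hs (Link.sd i)
    have hle := (rateDF_le_of_not_useful hs hA hu).trans
      (half_log_one_add_two_mul_le (mul_nonneg hg.le hP))
    have hr : A.rate s i ≤ A.shareDT i * Real.log (1 + s (Link.sd i) * A.powerDT i) +
        A.shareDF i * Real.log (1 + s (Link.sd i) * A.powerDF i) := by
      have := mul_le_mul_of_nonneg_left hle h2
      rw [rate, rateDT]
      linarith
    obtain ⟨Q, hQ0, hQ, hQr⟩ := exists_merged_power hg h1 h2 h3 hP (rate_nonneg hs hA i) hr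
    exact ⟨A.shareDT i + A.shareDF i, Q, 0, 0, add_nonneg h1 h2, hQ0, le_rfl, le_rfl, by ring,
      fun _ => rfl, by linarith, by rw [eta, hQr]; ring⟩

lemma RelayAlloc.exists_virtualAlloc {s : Fading M L} (hs : s.Positive)
    {A : RelayAlloc M L} (hA : A.Admissible) : ∃ a : VirtualAlloc M, a.Admissible s ∧
      a.power ≤ A.power ∧ ∀ i, a.rate s i = A.rate s i := by
  choose t₁ P₁ t₂ P₂ h1 h2 h3 h4 h5 h6 h7 h8 using exists_virtual_user hs hA
  refine ⟨⟨Sum.elim t₁ t₂, Sum.elim P₁ P₂⟩, ⟨?_, ?_, ?_⟩, ?_, h8⟩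
  · rintro (i | i)
    · exact ⟨h1 i, h2 i⟩
    · exact ⟨h3 i, h4 i⟩
  · rw [Fintype.sum_sum_type, ← Finset.sum_add_distrib, ← hA.2]
    exact Finset.sum_congr rfl fun i _ => h5 i
  · rintro (i | i) hi
    · exact absurd trivial hi
    · exact h6 i hi
  · rw [VirtualAlloc.power_eq, power_eq]
    exact Finset.sum_le_sum fun i _ => h7 i

/-! ## Equivalence over the blocks -/

lemma blockAvg_mono {x y : ℕ → ℝ} (h : ∀ k, x k ≤ y k) (K : ℕ) : blockAvg x K ≤ blockAvg y K :=
  div_le_div_of_nonneg_right (Finset.sum_le_sum fun k _ => h k) (Nat.cast_nonneg K)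

lemma longTermAvg_mono {x y : ℕ → ℝ} (h : ∀ k, x k ≤ y k) : longTermAvg x ≤ longTermAvg y :=
  limsup_le_limsup (Eventually.of_forall fun K => EReal.coe_le_coe_iff.2 (blockAvg_mono h K))

lemma RelayAlloc.exists_virtual_seq {g : ℕ → Fading M L} (hg : ∀ k, (g k).Positive)
    {Pbar : ℝ} {A : ℕ → RelayAlloc M L}
    (hA : IsFeasibleSeq (fun _ B => B.Admissible) power Pbar A) :
    ∃ a : ℕ → VirtualAlloc M,
      IsFeasibleSeq (fun k b => b.Admissible (g k)) VirtualAlloc.power Pbar a ∧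
      ∀ k i, (a k).rate (g k) i = (A k).rate (g k) i := by
  choose a h1 h2 h3 using fun k => exists_virtualAlloc (hg k) (hA.1 k)
  exact ⟨a, ⟨h1, (longTermAvg_mono h2).trans hA.2⟩, h3⟩

lemma VirtualAlloc.exists_relay_seq (hL : 0 < L) {g : ℕ → Fading M L}
    (hg : ∀ k, (g k).Positive) {Pbar : ℝ} {a : ℕ → VirtualAlloc M}
    (ha : IsFeasibleSeq (fun k b => b.Admissible (g k)) power Pbar a) :
    ∃ A : ℕ → RelayAlloc M L,
      IsFeasibleSeq (fun _ B => B.Admissible) RelayAlloc.power Pbar A ∧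
      ∀ k i, (A k).rate (g k) i = (a k).rate (g k) i := by
  choose A hA using fun k => exists_realizes hL (hg k) (ha.1 k)
  refine ⟨A, ⟨fun k => (hA k).1, ?_⟩, fun k i => (hA k).rate_eq (hg k) (ha.1 k) i⟩
  simp only [fun k => (hA k).power_eq (ha.1 k)]
  exact ha.2

lemma objective_congr {μ : Fin M → ℝ} {s : Fading M L} {a : VirtualAlloc M}
    {A : RelayAlloc M L} (h : ∀ i, a.rate s i = A.rate s i) :
    a.objective μ s = A.objective μ s := by
  rw [VirtualAlloc.objective_eq, RelayAlloc.objective]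
  exact Finset.sum_congr rfl fun i _ => by rw [h]

lemma region_eq (hL : 0 < L) {g : ℕ → Fading M L} (hg : ∀ k, (g k).Positive) (Pbar : ℝ) :
    RelayAlloc.region Pbar g = VirtualAlloc.region Pbar g := by
  ext R
  constructor
  · rintro ⟨A, hA, hR⟩
    obtain ⟨a, ha, har⟩ := RelayAlloc.exists_virtual_seq hg hA
    exact ⟨a, ha, fun i => by simpa only [har] using hR i⟩
  · rintro ⟨a, ha, hR⟩
    obtain ⟨A, hA, har⟩ := VirtualAlloc.exists_relay_seq hL hg ha
    exact ⟨A, hA, fun i => by simpa only [har] using hR i⟩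

lemma values_eq (hL : 0 < L) {g : ℕ → Fading M L} (hg : ∀ k, (g k).Positive) (Pbar : ℝ)
    (μ : Fin M → ℝ) : RelayAlloc.values μ Pbar g = VirtualAlloc.values μ Pbar g := by
  ext v
  constructor
  · rintro ⟨A, hA, rfl⟩
    obtain ⟨a, ha, har⟩ := RelayAlloc.exists_virtual_seq hg hA
    exact ⟨a, ha, by simp only [fun k => objective_congr (μ := μ) (har k)]⟩
  · rintro ⟨a, ha, rfl⟩
    obtain ⟨A, hA, har⟩ := VirtualAlloc.exists_relay_seq hL hg ha
    exact ⟨A, hA, by simp only [fun k => objective_congr (μ := μ) fun i => (har k i).symm]⟩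

/-- Competitors transfer in both directions with unchanged rates, so each optimality statement can
be tested against the competitors of the other problem. -/
lemma isOptimal_iff (hL : 0 < L) {g : ℕ → Fading M L} (hg : ∀ k, (g k).Positive) {Pbar : ℝ}
    {μ : Fin M → ℝ} {a : ℕ → VirtualAlloc M} {A : ℕ → RelayAlloc M L}
    (ha : ∀ k, (a k).Admissible (g k)) (hA : ∀ k, Realizes (g k) (a k) (A k)) :
    RelayAlloc.IsOptimal μ Pbar g A ↔ VirtualAlloc.IsOptimal μ Pbar g a := by
  have hobj : ∀ k, (A k).objective μ (g k) = (a k).objective μ (g k) := fun k =>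
    (hA k).objective_eq (hg k) (ha k) μ
  have hpow : ∀ k, (A k).power = (a k).power := fun k => (hA k).power_eq (ha k)
  simp only [RelayAlloc.IsOptimal, VirtualAlloc.IsOptimal, IsOptimalSeq, hobj]
  refine and_congr ?_ ⟨fun h b hb => ?_, fun h B hB => ?_⟩
  · simp only [IsFeasibleSeq, hpow]
    exact and_congr_left' ⟨fun _ => ha, fun _ k => (hA k).1⟩
  · obtain ⟨B, hB, hBr⟩ := VirtualAlloc.exists_relay_seq hL hg hb
    have := h B hB
    simpa only [← fun k => objective_congr (μ := μ) fun i => (hBr k i).symm] using this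
  · obtain ⟨b, hb, hbr⟩ := RelayAlloc.exists_virtual_seq hg hB
    have := h b hb
    simpa only [← fun k => objective_congr (μ := μ) (hbr k)] using this

/-! ## Scheduling in a single block -/

lemma waterPower_nonneg (μ : Fin M → ℝ) (price : ℝ) (s : Fading M L) (j : VUser M) :
    0 ≤ waterPower μ price s j := le_max_right _ _

/-- The net value of virtual user `j` at its water-filling power. -/
def userValue (μ : Fin M → ℝ) (price : ℝ) (s : Fading M L) (j : VUser M) : ℝ :=
  f μ s j (waterPower μ price s j) - price * waterPower μ price s j

lemma userValue_eq (μ : Fin M → ℝ) (price : ℝ) (s : Fading M L) (j : VUser M) :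
    userValue μ price s j = optValue (omega μ j) (eta s j) price := rfl

lemma isScheduled_iff {μ : Fin M → ℝ} {price : ℝ} {s : Fading M L} {m : VUser M} :
    IsScheduled μ price s m ↔
      Present s m ∧ ∀ j, Present s j → userValue μ price s j ≤ userValue μ price s m := Iff.rfl

section Block

variable {μ : Fin M → ℝ} {price : ℝ} {s : Fading M L}

lemma IsScheduled.userValue_eq {m m' : VUser M} (h : IsScheduled μ price s m)
    (h' : IsScheduled μ price s m') : userValue μ price s m = userValue μ price s m' :=
  le_antisymm (h'.2 m h.1) (h.2 m' h'.1)

lemma IsScheduled.of_le {m m' : VUser M} (h : IsScheduled μ price s m) (hm' : Present s m')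
    (hle : userValue μ price s m ≤ userValue μ price s m') : IsScheduled μ price s m' :=
  ⟨hm', fun j hj => (h.2 j hj).trans hle⟩

lemma userValue_nonneg (hμ : ∀ i, 0 ≤ μ i) (hp : 0 < price) (hs : s.Positive) {j : VUser M}
    (hj : Present s j) : 0 ≤ userValue μ price s j :=
  optValue_nonneg (omega_nonneg hμ j) (eta_pos hs hj) hp

lemma userValue_pos_iff (hμ : ∀ i, 0 ≤ μ i) (hp : 0 < price) (hs : s.Positive) {j : VUser M}
    (hj : Present s j) : 0 < userValue μ price s j ↔ 0 < waterPower μ price s j :=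
  optValue_pos_iff (omega_nonneg hμ j) (eta_pos hs hj) hp

lemma IsScheduled.waterPower_eq_zero (hμ : ∀ i, 0 ≤ μ i) (hp : 0 < price) (hs : s.Positive)
    {m j : VUser M} (h : IsScheduled μ price s m) (h0 : waterPower μ price s m = 0)
    (hj : Present s j) : waterPower μ price s j = 0 := by
  by_contra hne
  have h1 := (waterPower_nonneg μ price s j).lt_of_ne' hne
  have h2 := (userValue_pos_iff hμ hp hs hj).2 h1
  have h3 := (userValue_pos_iff hμ hp hs h.1).1 (h2.trans_le (h.2 j hj))
  exact h3.ne' h0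

lemma exists_isScheduled (hM : 0 < M) (μ : Fin M → ℝ) (price : ℝ) (s : Fading M L) :
    ∃ m, IsScheduled μ price s m := by
  classical
  obtain ⟨m, hm, hmax⟩ := Finset.exists_max_image (Finset.univ.filter fun j => Present s j)
    (userValue μ price s) ⟨Sum.inl ⟨0, hM⟩, Finset.mem_filter.2 ⟨Finset.mem_univ _, trivial⟩⟩
  exact ⟨m, by simpa using hm, fun j hj => hmax j (by simpa using hj)⟩

lemma f_sub_le_userValue (hμ : ∀ i, 0 ≤ μ i) (hp : 0 < price) (hs : s.Positive) {j : VUser M}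
    (hj : Present s j) {P : ℝ} (hP : 0 ≤ P) : f μ s j P - price * P ≤ userValue μ price s j :=
  netValue_le_optValue (omega_nonneg hμ j) (eta_pos hs hj) hp hP

lemma eq_waterPower_of_le (hμ : ∀ i, 0 ≤ μ i) (hp : 0 < price) (hs : s.Positive) {j : VUser M}
    (hj : Present s j) {P : ℝ} (hP : 0 ≤ P) (h : userValue μ price s j ≤ f μ s j P - price * P) :
    P = waterPower μ price s j := by
  by_contra hne
  exact absurd (netValue_lt_optValue (omega_nonneg hμ j) (eta_pos hs hj) hp hP hne) (not_lt.2 h)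

/-- The loss of an allocation against the scheduled user, at the given power price. -/
lemma VirtualAlloc.sum_loss {a : VirtualAlloc M} (ha : a.Admissible s) (V : ℝ) :
    ∑ j, a.share j * (V - (f μ s j (a.pow j) - price * a.pow j)) =
      V + price * a.power - a.objective μ s := by
  have : ∀ j, a.share j * (V - (f μ s j (a.pow j) - price * a.pow j)) =
      a.share j * V + price * (a.share j * a.pow j) - a.share j * f μ s j (a.pow j) :=
    fun j => by ring
  simp only [this, Finset.sum_sub_distrib, Finset.sum_add_distrib, ← Finset.sum_mul,
    ← Finset.mul_sum, ha.2.1, one_mul, power, objective]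

lemma VirtualAlloc.loss_nonneg (hμ : ∀ i, 0 ≤ μ i) (hp : 0 < price) (hs : s.Positive)
    {a : VirtualAlloc M} (ha : a.Admissible s) {m : VUser M} (hm : IsScheduled μ price s m)
    (j : VUser M) :
    0 ≤ a.share j * (userValue μ price s m - (f μ s j (a.pow j) - price * a.pow j)) := by
  by_cases hj : Present s j
  · refine mul_nonneg (ha.1 j).1 (sub_nonneg.2 ?_)
    exact (f_sub_le_userValue hμ hp hs hj (ha.1 j).2).trans (hm.2 j hj)
  · rw [ha.2.2 j hj, zero_mul]

/-- Weak duality in one block: the slack is a sum of nonnegative losses, one per virtual user,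
weighted by the ratios. -/
lemma VirtualAlloc.objective_le (hμ : ∀ i, 0 ≤ μ i) (hp : 0 < price) (hs : s.Positive)
    {a : VirtualAlloc M} (ha : a.Admissible s) {m : VUser M} (hm : IsScheduled μ price s m) :
    a.objective μ s ≤ userValue μ price s m + price * a.power := by
  have := sum_loss (μ := μ) (price := price) ha (userValue μ price s m)
  have h2 := Finset.sum_nonneg fun j (_ : j ∈ Finset.univ) => loss_nonneg hμ hp hs ha hm j
  linarith

/-- Zero total loss makes every weighted loss zero; strict optimality of the water-filling power
then fixes the power of each user with a positive ratio. -/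
lemma VirtualAlloc.scheduled_of_objective_eq (hμ : ∀ i, 0 ≤ μ i) (hp : 0 < price)
    (hs : s.Positive) {a : VirtualAlloc M} (ha : a.Admissible s) {m : VUser M}
    (hm : IsScheduled μ price s m)
    (h : a.objective μ s = userValue μ price s m + price * a.power) {j : VUser M}
    (hj : 0 < a.share j) : IsScheduled μ price s j ∧ a.pow j = waterPower μ price s j := by
  have hsum := sum_loss (μ := μ) (price := price) ha (userValue μ price s m)
  rw [h, sub_self, Finset.sum_eq_zero_iff_of_nonneg fun j _ => loss_nonneg hμ hp hs ha hm j]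
    at hsum
  have h0 := (mul_eq_zero.1 (hsum j (Finset.mem_univ j))).resolve_left hj.ne'
  have hpres : Present s j := by
    by_contra hn
    exact hj.ne' (ha.2.2 j hn)
  have h1 := f_sub_le_userValue hμ hp hs hpres (ha.1 j).2
  have h2 := hm.2 j hpres
  change userValue μ price s j ≤ userValue μ price s m at h2
  exact ⟨hm.of_le hpres (by linarith), eq_waterPower_of_le hμ hp hs hpres (ha.1 j).2 (by linarith)⟩

/-- The rate of user `i` when the block is given to virtual user `m`. -/
def scheduledRate (μ : Fin M → ℝ) (price : ℝ) (s : Fading M L) (m : VUser M) (i : Fin M) : ℝ :=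
  (if m = Sum.inl i then 1 else if m = Sum.inr i then 1 / 2 else 0) *
    Real.log (1 + eta s m * waterPower μ price s m)

lemma VirtualAlloc.power_of_single {a : VirtualAlloc M} {m : VUser M} (h1 : a.share m = 1)
    (h2 : ∀ l, l ≠ m → a.share l = 0) : a.power = a.pow m := by
  rw [power, Finset.sum_eq_single m (fun j _ hj => by rw [h2 j hj, zero_mul]) (by simp), h1,
    one_mul]

lemma VirtualAlloc.rate_of_single {a : VirtualAlloc M} {m : VUser M} (h1 : a.share m = 1)
    (h2 : ∀ l, l ≠ m → a.share l = 0) (h3 : a.pow m = waterPower μ price s m) (i : Fin M) :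
    a.rate s i = scheduledRate μ price s m i := by
  rw [rate, scheduledRate, ← h3]
  by_cases hl : m = Sum.inl i
  · subst hl
    rw [h1, h2 (Sum.inr i) (by simp)]
    simp
  by_cases hr : m = Sum.inr i
  · subst hr
    rw [h1, h2 (Sum.inl i) (by simp)]
    simp
  · rw [h2 _ (Ne.symm hl), h2 _ (Ne.symm hr)]
    simp [hl, hr]

lemma VirtualAlloc.objective_of_single {a : VirtualAlloc M} {m : VUser M} (h1 : a.share m = 1)
    (h2 : ∀ l, l ≠ m → a.share l = 0) : a.objective μ s = f μ s m (a.pow m) := by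
  rw [objective, Finset.sum_eq_single m (fun j _ hj => by rw [h2 j hj, zero_mul]) (by simp), h1,
    one_mul]

/-- Fading states in which the scheduled user is determined (if it carries power), and so are
the best relays. -/
structure Generic (μ : Fin M → ℝ) (price : ℝ) (s : Fading M L) : Prop where
  pos : s.Positive
  scheduled : ∀ m m', IsScheduled μ price s m → IsScheduled μ price s m' →
    0 < waterPower μ price s m → m = m'
  relay : ∀ i l l', IsBestRelay s i l → IsBestRelay s i l' → l = l'

/-- Any remaining tie is between users without power, so power and rates of water-filling do not
depend on which maximizer is chosen. -/
lemma Generic.eq_or (h : Generic μ price s) {m m' : VUser M} (hm : IsScheduled μ price s m)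
    (hm' : IsScheduled μ price s m') :
    m = m' ∨ waterPower μ price s m = 0 ∧ waterPower μ price s m' = 0 := by
  by_contra hne
  rw [not_or, not_and_or] at hne
  obtain ⟨h1, h2 | h2⟩ := hne
  · exact h1 (h.scheduled m m' hm hm' ((waterPower_nonneg μ price s m).lt_of_ne' h2))
  · exact h1 (h.scheduled m' m hm' hm ((waterPower_nonneg μ price s m').lt_of_ne' h2)).symm

lemma IsWaterFilling.power_eq (h : Generic μ price s) {a : VirtualAlloc M} {m : VUser M}
    (ha : IsWaterFilling μ price s a) (hm : IsScheduled μ price s m) :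
    a.power = waterPower μ price s m := by
  obtain ⟨-, m', hm', h1, h2, h3⟩ := ha
  rw [VirtualAlloc.power_of_single h1 h2, h3]
  rcases h.eq_or hm hm' with rfl | ⟨h4, h5⟩
  · rfl
  · rw [h4, h5]

lemma IsWaterFilling.rate_eq (h : Generic μ price s) {a : VirtualAlloc M} {m : VUser M}
    (ha : IsWaterFilling μ price s a) (hm : IsScheduled μ price s m) (i : Fin M) :
    a.rate s i = scheduledRate μ price s m i := by
  obtain ⟨-, m', hm', h1, h2, h3⟩ := ha
  rw [VirtualAlloc.rate_of_single h1 h2 h3]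
  rcases h.eq_or hm hm' with rfl | ⟨h4, h5⟩
  · rfl
  · simp [scheduledRate, h4, h5]

lemma IsWaterFilling.objective_eq {a : VirtualAlloc M} {m : VUser M}
    (ha : IsWaterFilling μ price s a) (hm : IsScheduled μ price s m) :
    a.objective μ s = userValue μ price s m + price * a.power := by
  obtain ⟨-, m', hm', h1, h2, h3⟩ := ha
  rw [hm.userValue_eq hm', VirtualAlloc.power_of_single h1 h2,
    VirtualAlloc.objective_of_single h1 h2, h3, userValue]
  ring

lemma VirtualAlloc.active_of_zero {a : VirtualAlloc M} {j : VUser M}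
    (h : 0 < a.share j → a.pow j = 0) : a.active j = none := by
  refine if_neg ?_
  rintro ⟨h1, h2⟩
  exact h2.ne' (h h1)

/-- An allocation without loss has the active sub-channels of water-filling. -/
lemma VirtualAlloc.active_eq (hμ : ∀ i, 0 ≤ μ i) (hp : 0 < price) (hg : Generic μ price s)
    {a b : VirtualAlloc M} (ha : a.Admissible s) (hb : IsWaterFilling μ price s b) {m : VUser M}
    (hm : IsScheduled μ price s m)
    (h : a.objective μ s = userValue μ price s m + price * a.power) : a.active = b.active := by
  obtain ⟨-, n, hn, h1, h2, h3⟩ := hb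
  rw [hm.userValue_eq hn] at h
  have key := fun j => scheduled_of_objective_eq hμ hp hg.pos ha hn h (j := j)
  funext j
  rcases (waterPower_nonneg μ price s n).eq_or_lt with h0 | h0
  · rw [active_of_zero, active_of_zero]
    · intro hj
      by_cases hjn : j = n
      · rw [hjn, h3, ← h0]
      · exact absurd (h2 j hjn) hj.ne'
    · intro hj
      rw [(key j hj).2]
      exact hn.waterPower_eq_zero hμ hp hg.pos h0.symm (key j hj).1.1
  · have hz : ∀ j, j ≠ n → a.share j = 0 := by
      intro j hj
      by_contra hne
      exact hj (hg.scheduled n j hn (key j ((ha.1 j).1.lt_of_ne' hne)).1 h0).symm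
    have ha1 : a.share n = 1 := by
      rw [← ha.2.1, Finset.sum_eq_single n (fun j _ hj => hz j hj) (by simp)]
    by_cases hj : j = n
    · subst hj
      have := (key j (by rw [ha1]; exact one_pos)).2
      simp only [active, ha1, h1, h3, this]
    · rw [active_of_zero fun h => absurd (hz j hj) h.ne',
        active_of_zero fun h => absurd (h2 j hj) h.ne']

/-! ### Losses in the relay-assisted channel -/

/-- Net value of the decode-and-forward link. -/
def RelayAlloc.netDF (μ : Fin M → ℝ) (price : ℝ) (s : Fading M L) (A : RelayAlloc M L)
    (i : Fin M) : ℝ := μ i * A.rateDF s i - price * A.powerDF i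

/-- Net value of the direct link. -/
def RelayAlloc.netDT (μ : Fin M → ℝ) (price : ℝ) (s : Fading M L) (A : RelayAlloc M L)
    (i : Fin M) : ℝ := μ i * A.rateDT s i - price * A.powerDT i

lemma RelayAlloc.netDF_le (hμ : ∀ i, 0 ≤ μ i) (hp : 0 < price) (hs : s.Positive)
    {A : RelayAlloc M L} (hA : A.Admissible) {m : VUser M} (hm : IsScheduled μ price s m)
    (i : Fin M) : A.netDF μ price s i ≤ userValue μ price s m := by
  have hP := hA.powerDF_nonneg i
  by_cases hi : Present s (Sum.inr i)
  · have h1 := mul_le_mul_of_nonneg_left (rateDF_le_of_present hs hA hi) (hμ i)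
    have h2 := (f_sub_le_userValue hμ hp hs hi hP).trans (hm.2 _ hi)
    change _ ≤ userValue μ price s m at h2
    rw [f, omega] at h2
    rw [netDF]
    linarith
  · have hu : ¬ Useful s i (A.relay i) := fun h => hi ⟨_, h⟩
    have h1 := mul_le_mul_of_nonneg_left ((rateDF_le_of_not_useful hs hA hu).trans
      (half_log_one_add_two_mul_le (mul_nonneg (hs (Link.sd i)).le hP))) (hμ i)
    have h2 := (f_sub_le_userValue hμ hp hs (j := Sum.inl i) trivial hP).trans
      (hm.2 (Sum.inl i) trivial)
    change _ ≤ userValue μ price s m at h2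
    rw [f, omega, eta] at h2
    rw [netDF]
    linarith

lemma RelayAlloc.netDT_le (hμ : ∀ i, 0 ≤ μ i) (hp : 0 < price) (hs : s.Positive)
    {A : RelayAlloc M L} (hA : A.Admissible) {m : VUser M} (hm : IsScheduled μ price s m)
    (i : Fin M) : A.netDT μ price s i ≤ userValue μ price s m := by
  obtain ⟨-, -, hP, -, -⟩ := hA.1 i
  exact (f_sub_le_userValue hμ hp hs (j := Sum.inl i) trivial hP).trans (hm.2 (Sum.inl i) trivial)

lemma RelayAlloc.scheduled_of_netDT_eq (hμ : ∀ i, 0 ≤ μ i) (hp : 0 < price) (hs : s.Positive)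
    {A : RelayAlloc M L} (hA : A.Admissible) {m : VUser M} (hm : IsScheduled μ price s m)
    {i : Fin M} (h : A.netDT μ price s i = userValue μ price s m) :
    IsScheduled μ price s (Sum.inl i) ∧ A.powerDT i = waterPower μ price s (Sum.inl i) := by
  obtain ⟨-, -, hP, -, -⟩ := hA.1 i
  have h1 := f_sub_le_userValue hμ hp hs (j := Sum.inl i) trivial hP
  have h2 := hm.2 (Sum.inl i) trivial
  change userValue μ price s (Sum.inl i) ≤ userValue μ price s m at h2
  change f μ s (Sum.inl i) (A.powerDT i) - price * A.powerDT i = _ at h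
  exact ⟨hm.of_le trivial (by linarith), eq_waterPower_of_le hμ hp hs (j := Sum.inl i) trivial hP (by linarith)⟩

/-- Every inequality between the relay link and the scheduled user must be tight: the hops are
balanced, the relay has the best gain, and the power is the water-filling one. A relay that is not
useful is excluded by the strict form of the half-rate inequality. -/
lemma RelayAlloc.scheduled_of_netDF_eq (hμ : ∀ i, 0 ≤ μ i) (hp : 0 < price) (hs : s.Positive)
    {A : RelayAlloc M L} (hA : A.Admissible) {m : VUser M} (hm : IsScheduled μ price s m)
    {i : Fin M} (h : A.netDF μ price s i = userValue μ price s m) (hpow : 0 < A.powerDF i) :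
    IsScheduled μ price s (Sum.inr i) ∧ A.powerDF i = waterPower μ price s (Sum.inr i) ∧
      IsBestRelay s i (A.relay i) ∧ A.powerS i = splitPower s i (A.relay i) (A.powerDF i) := by
  have hg := hs (Link.sd i)
  have hVnn := userValue_nonneg hμ hp hs hm.1
  -- With weight zero the net value would be minus the cost of a positive power, below the
  -- nonnegative scheduled value.
  have hμi : 0 < μ i := by
    rcases (hμ i).eq_or_lt with h0 | h0
    · rw [netDF, ← h0, zero_mul] at h
      nlinarith
    · exact h0
  rw [netDF] at h
  by_cases hu : Useful s i (A.relay i)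
  · have hi : Present s (Sum.inr i) := ⟨_, hu⟩
    have hga := one_lt_gain hu
    have h1 := rateDF_le_of_present hs hA hi
    have h1' := mul_le_mul_of_nonneg_left h1 hμi.le
    have h2 := f_sub_le_userValue hμ hp hs hi hpow.le
    have h3 := hm.2 _ hi
    change userValue μ price s (Sum.inr i) ≤ userValue μ price s m at h3
    have h4 : f μ s (Sum.inr i) (A.powerDF i) =
      μ i * (1 / 2 * Real.log (1 + eta s (Sum.inr i) * A.powerDF i)) := by rw [f, omega]; ring
    have hrate : A.rateDF s i = 1 / 2 * Real.log (1 + eta s (Sum.inr i) * A.powerDF i) :=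
      le_antisymm h1 (le_of_mul_le_mul_left (by linarith) hμi)
    have hmin0 := min_hop_nonneg hs hA i
    have hle := (min_hop_le hs hu (A.powerS i) (A.powerR i)).1
    have heq := (min_hop_le hs hu (A.powerS i) (A.powerR i)).2
    have hPe : (A.powerS i + A.powerR i) / 2 = A.powerDF i := by rw [powerDF]; ring
    rw [hPe] at hle heq
    have hbest : 2 * s (Link.sd i) * gain s i (A.relay i) * A.powerDF i ≤
        eta s (Sum.inr i) * A.powerDF i := by
      have := gain_le_bestGain hu
      rw [eta]
      gcongr
    have hmin : min (s (Link.sr (A.relay i)) * A.powerS i)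
        (s (Link.sd i) * A.powerS i + s (Link.rd (A.relay i) i) * A.powerR i) =
        eta s (Sum.inr i) * A.powerDF i := by
      rw [rateDF_eq hs hA] at hrate
      have := Real.log_injOn_pos (x₁ := 1 + min (s (Link.sr (A.relay i)) * A.powerS i)
        (s (Link.sd i) * A.powerS i + s (Link.rd (A.relay i) i) * A.powerR i))
        (x₂ := 1 + eta s (Sum.inr i) * A.powerDF i)
        (by simp only [Set.mem_Ioi]; linarith)
        (by simp only [Set.mem_Ioi]; linarith) (by linarith)
      linarith
    refine ⟨hm.of_le hi (by linarith), eq_waterPower_of_le hμ hp hs hi hpow.le (by linarith),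
      ⟨hu, fun l' hl' => ?_⟩, heq (by linarith)⟩
    -- The minimum of the hops equals the best-gain expression and is at most the expression for the
    -- relay in use, which is at most the best-gain one; hence all three agree.
    have h5 : eta s (Sum.inr i) * A.powerDF i =
      2 * s (Link.sd i) * gain s i (A.relay i) * A.powerDF i := by linarith
    rw [eta] at h5
    have h6 := mul_left_cancel₀ (by positivity) (mul_right_cancel₀ hpow.ne' h5)
    rw [← h6]
    exact gain_le_bestGain hl'
  · exfalso
    have h1 := mul_lt_mul_of_pos_left ((rateDF_le_of_not_useful hs hA hu).trans_lt
      (half_log_one_add_two_mul_lt (mul_pos hg hpow))) hμi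
    have h2 := (f_sub_le_userValue hμ hp hs (j := Sum.inl i) trivial hpow.le).trans
      (hm.2 (Sum.inl i) trivial)
    change _ ≤ userValue μ price s m at h2
    rw [f, omega, eta] at h2
    linarith

lemma RelayAlloc.sum_loss {A : RelayAlloc M L} (hA : A.Admissible) (V : ℝ) :
    ∑ i, (A.shareDT i * (V - A.netDT μ price s i) + A.shareDF i * (V - A.netDF μ price s i)) =
      V + price * A.power - A.objective μ s := by
  have : ∀ i, A.shareDT i * (V - A.netDT μ price s i) + A.shareDF i * (V - A.netDF μ price s i) =
      (A.shareDT i + A.shareDF i) * V +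
        price * (A.shareDT i * A.powerDT i + A.shareDF i * A.powerDF i) - μ i * A.rate s i :=
    fun i => by rw [netDT, netDF, rate]; ring
  simp only [this, Finset.sum_sub_distrib]
  rw [Finset.sum_add_distrib, ← Finset.sum_mul, ← Finset.mul_sum, hA.2, one_mul, power_eq,
    objective]

lemma RelayAlloc.lossDT_nonneg (hμ : ∀ i, 0 ≤ μ i) (hp : 0 < price) (hs : s.Positive)
    {A : RelayAlloc M L} (hA : A.Admissible) {m : VUser M} (hm : IsScheduled μ price s m)
    (i : Fin M) : 0 ≤ A.shareDT i * (userValue μ price s m - A.netDT μ price s i) :=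
  mul_nonneg (hA.1 i).1 (sub_nonneg.2 (netDT_le hμ hp hs hA hm i))

lemma RelayAlloc.lossDF_nonneg (hμ : ∀ i, 0 ≤ μ i) (hp : 0 < price) (hs : s.Positive)
    {A : RelayAlloc M L} (hA : A.Admissible) {m : VUser M} (hm : IsScheduled μ price s m)
    (i : Fin M) : 0 ≤ A.shareDF i * (userValue μ price s m - A.netDF μ price s i) :=
  mul_nonneg (hA.1 i).2.1 (sub_nonneg.2 (netDF_le hμ hp hs hA hm i))

lemma RelayAlloc.objective_le (hμ : ∀ i, 0 ≤ μ i) (hp : 0 < price) (hs : s.Positive)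
    {A : RelayAlloc M L} (hA : A.Admissible) {m : VUser M} (hm : IsScheduled μ price s m) :
    A.objective μ s ≤ userValue μ price s m + price * A.power := by
  have := sum_loss (μ := μ) (price := price) (s := s) hA (userValue μ price s m)
  have h2 := Finset.sum_nonneg fun i (_ : i ∈ Finset.univ) =>
    add_nonneg (lossDT_nonneg hμ hp hs hA hm i) (lossDF_nonneg hμ hp hs hA hm i)
  linarith

lemma RelayAlloc.net_eq_of_objective_eq (hμ : ∀ i, 0 ≤ μ i) (hp : 0 < price)
    (hs : s.Positive) {A : RelayAlloc M L} (hA : A.Admissible) {m : VUser M}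
    (hm : IsScheduled μ price s m)
    (h : A.objective μ s = userValue μ price s m + price * A.power) (i : Fin M) :
    (0 < A.shareDT i → A.netDT μ price s i = userValue μ price s m) ∧
      (0 < A.shareDF i → A.netDF μ price s i = userValue μ price s m) := by
  have hsum := sum_loss (μ := μ) (price := price) (s := s) hA (userValue μ price s m)
  have n1 := lossDT_nonneg hμ hp hs hA hm
  have n2 := lossDF_nonneg hμ hp hs hA hm
  rw [h, sub_self, Finset.sum_eq_zero_iff_of_nonneg fun i _ => add_nonneg (n1 i) (n2 i)] at hsum
  have h0 := hsum i (Finset.mem_univ i)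
  have h1 := n1 i
  have h2 := n2 i
  constructor
  · intro hi
    have := (mul_eq_zero.1 (by linarith :
      A.shareDT i * (userValue μ price s m - A.netDT μ price s i) = 0)).resolve_left hi.ne'
    linarith
  · intro hi
    have := (mul_eq_zero.1 (by linarith :
      A.shareDF i * (userValue μ price s m - A.netDF μ price s i) = 0)).resolve_left hi.ne'
    linarith

lemma RelayAlloc.activeDT_of_zero {A : RelayAlloc M L} {i : Fin M}
    (h : 0 < A.shareDT i → A.powerDT i = 0) : A.activeDT i = none := by
  refine if_neg ?_
  rintro ⟨h1, h2⟩
  exact h2.ne' (h h1)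

lemma RelayAlloc.activeDF_of_zero {A : RelayAlloc M L} {i : Fin M}
    (h : 0 < A.shareDF i → A.powerDF i = 0) : A.activeDF i = none := by
  refine if_neg ?_
  rintro ⟨h1, h2⟩
  have := h h1
  rw [powerDF] at this
  linarith

lemma RelayAlloc.activeDT_eq {A : RelayAlloc M L} {i : Fin M} {t P : ℝ} (h1 : A.shareDT i = t)
    (h2 : A.powerDT i = P) (ht : 0 < t) (hP : 0 < P) : A.activeDT i = some (t, P) := by
  rw [activeDT, if_pos (by rw [h1, h2]; exact ⟨ht, hP⟩), h1, h2]

lemma RelayAlloc.activeDF_eq {A : RelayAlloc M L} {i : Fin M} {l : Fin L} {t P : ℝ}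
    (h1 : A.shareDF i = t) (h2 : A.powerDF i = P) (hl : A.relay i = l)
    (hS : A.powerS i = splitPower s i l P) (ht : 0 < t) (hP : 0 < P) :
    A.activeDF i = some (l, t, splitPower s i l P, 2 * P - splitPower s i l P) := by
  rw [powerDF] at h2
  rw [activeDF, if_pos (by rw [h1]; exact ⟨ht, by linarith⟩), h1, hl, hS,
    show A.powerR i = 2 * P - splitPower s i l P by linarith]

/-- A relay allocation without loss has the active sub-channels of water-filling. -/
lemma RelayAlloc.active_eq (hμ : ∀ i, 0 ≤ μ i) (hp : 0 < price) (hg : Generic μ price s)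
    {A B : RelayAlloc M L} {b : VirtualAlloc M} (hA : A.Admissible)
    (hb : IsWaterFilling μ price s b) (hB : Realizes s b B) {m : VUser M}
    (hm : IsScheduled μ price s m)
    (h : A.objective μ s = userValue μ price s m + price * A.power) :
    A.activeDT = B.activeDT ∧ A.activeDF = B.activeDF := by
  obtain ⟨hbA, n, hn, h1, h2, h3⟩ := hb
  rw [hm.userValue_eq hn] at h
  have key := net_eq_of_objective_eq hμ hp hg.pos hA hn h
  have keyT := fun i hi => scheduled_of_netDT_eq hμ hp hg.pos hA hn ((key i).1 hi)
  have keyF := fun i hi => scheduled_of_netDF_eq hμ hp hg.pos hA hn ((key i).2 hi)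
  have BS : ∀ i, Present s (Sum.inr i) → B.powerDF i = b.pow (Sum.inr i) := by
    intro i hi
    obtain ⟨-, -, -, h7⟩ := hB.2 i
    rw [powerDF, (h7 hi).2.2]
    ring
  have presF : ∀ i, 0 < B.shareDF i → Present s (Sum.inr i) := by
    intro i hi
    by_contra hn
    rw [(hB.2 i).2.2.1, hbA.2.2 _ hn] at hi
    exact lt_irrefl _ hi
  rcases (waterPower_nonneg μ price s n).eq_or_lt with h0 | h0
  · have bz : ∀ j, 0 < b.share j → b.pow j = 0 := by
      intro j hj
      by_cases hjn : j = n
      · rw [hjn, h3, ← h0]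
      · exact absurd (h2 j hjn) hj.ne'
    constructor <;> funext i
    · rw [activeDT_of_zero, activeDT_of_zero]
      · intro hi
        rw [(hB.2 i).2.1]
        exact bz _ ((hB.2 i).1 ▸ hi)
      · intro hi
        rw [(keyT i hi).2]
        exact hn.waterPower_eq_zero hμ hp hg.pos h0.symm trivial
    · rw [activeDF_of_zero, activeDF_of_zero]
      · intro hi
        rw [BS i (presF i hi)]
        exact bz _ ((hB.2 i).2.2.1 ▸ hi)
      · intro hi
        by_contra hne
        have hpos := (hA.powerDF_nonneg i).lt_of_ne' hne
        obtain ⟨h4, h5, -⟩ := keyF i hi hpos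
        exact hne (h5.trans (hn.waterPower_eq_zero hμ hp hg.pos h0.symm h4.1))
  · have hV := (userValue_pos_iff hμ hp hg.pos hn.1).2 h0
    -- A DF link with time but no power has net value at most zero, while the scheduled value is
    -- positive here.
    have posF : ∀ i, 0 < A.shareDF i → 0 < A.powerDF i := by
      intro i hi
      refine (hA.powerDF_nonneg i).lt_of_ne' fun hz => ?_
      have hle : A.rateDF s i ≤ 0 := by
        by_cases hi' : Present s (Sum.inr i)
        · simpa [hz] using rateDF_le_of_present hg.pos hA hi'
        · have hu : ¬ Useful s i (A.relay i) := fun h => hi' ⟨_, h⟩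
          simpa [hz] using rateDF_le_of_not_useful hg.pos hA hu
      have := (key i).2 hi
      rw [netDF, hz] at this
      nlinarith [hμ i]
    have zT : ∀ i, Sum.inl i ≠ n → A.shareDT i = 0 := by
      intro i hi
      by_contra hne
      exact hi (hg.scheduled n _ hn (keyT i ((hA.1 i).1.lt_of_ne' hne)).1 h0).symm
    have zF : ∀ i, Sum.inr i ≠ n → A.shareDF i = 0 := by
      intro i hi
      by_contra hne
      have hpos := (hA.1 i).2.1.lt_of_ne' hne
      exact hi (hg.scheduled n _ hn (keyF i hpos (posF i hpos)).1 h0).symm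
    have zTB : ∀ i, Sum.inl i ≠ n → B.shareDT i = 0 := fun i hi =>
      (hB.2 i).1.trans (h2 _ hi)
    have zFB : ∀ i, Sum.inr i ≠ n → B.shareDF i = 0 := fun i hi =>
      (hB.2 i).2.2.1.trans (h2 _ hi)
    have dtz : ∀ i, Sum.inl i ≠ n → A.activeDT i = B.activeDT i := fun i hi => by
      rw [activeDT_of_zero fun h => absurd (zT i hi) h.ne',
        activeDT_of_zero fun h => absurd (zTB i hi) h.ne']
    have dfz : ∀ i, Sum.inr i ≠ n → A.activeDF i = B.activeDF i := fun i hi => by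
      rw [activeDF_of_zero fun h => absurd (zF i hi) h.ne',
        activeDF_of_zero fun h => absurd (zFB i hi) h.ne']
    have hsum := hA.2
    rcases n with i | i
    · refine ⟨funext fun i' => ?_, funext fun i' => dfz i' (by simp)⟩
      by_cases hi : i' = i
      · subst hi
        have hone : A.shareDT i' = 1 := by
          rw [← hsum, Finset.sum_eq_single i' (fun k _ hk => by
            rw [zT k (by simpa using hk), zF k (by simp), add_zero]) (by simp), zF i' (by simp),
            add_zero]
        rw [activeDT_eq hone (keyT i' (hone ▸ one_pos)).2 one_pos h0,
          activeDT_eq ((hB.2 i').1.trans h1) ((hB.2 i').2.1.trans h3) one_pos h0]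
      · exact dtz i' (by simpa using hi)
    · refine ⟨funext fun i' => dtz i' (by simp), funext fun i' => ?_⟩
      by_cases hi : i' = i
      · subst hi
        have hone : A.shareDF i' = 1 := by
          rw [← hsum, Finset.sum_eq_single i' (fun k _ hk => by
            rw [zF k (by simpa using hk), zT k (by simp), add_zero]) (by simp), zT i' (by simp),
            zero_add]
        have hsh : 0 < A.shareDF i' := hone ▸ one_pos
        obtain ⟨-, k2, k3, k4⟩ := keyF i' hsh (posF i' hsh)
        obtain ⟨-, -, b3, b4⟩ := hB.2 i'
        obtain ⟨b5, b6, -⟩ := b4 hn.1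
        have hrel := hg.relay i' _ _ k3 b5
        rw [activeDF_eq (s := s) hone k2 hrel (by rw [k4, hrel, k2]) one_pos h0,
          activeDF_eq (s := s) (b3.trans h1) ((BS i' hn.1).trans h3) rfl
            (by rw [← h3]; exact b6) one_pos h0]
      · exact dfz i' (by simpa using hi)

end Block

/-! ## Measurable selections -/

/-- Choosing the first admissible index of a finite enumeration makes each level set a finite
Boolean combination of the given sets. -/
lemma exists_measurable_selection {α ι : Type*} [MeasurableSpace α] [Finite ι] {Q : α → ι → Prop}
    (hQ : ∀ i, MeasurableSet {x | Q x i}) (hne : ∀ x, ∃ i, Q x i) :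
    ∃ c : α → ι, (∀ x, Q x (c x)) ∧ ∀ i, MeasurableSet {x | c x = i} := by
  classical
  have := Fintype.ofFinite ι
  let e := Fintype.equivFin ι
  have : ∀ x, ∃ i, Q x i ∧ ∀ j, e j < e i → ¬ Q x j := by
    intro x
    obtain ⟨i₀, h₀⟩ := hne x
    obtain ⟨i, hi, hmin⟩ := Finset.exists_min_image (Finset.univ.filter fun i => Q x i) e
      ⟨i₀, by simpa using h₀⟩
    exact ⟨i, by simpa using hi, fun j hj hQj => absurd (hmin j (by simpa using hQj))
      (not_le.2 hj)⟩
  choose c hc hmin using this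
  refine ⟨c, hc, fun i => ?_⟩
  have : {x | c x = i} = {x | Q x i} ∩ ⋂ j, ⋂ (_ : e j < e i), {x | Q x j}ᶜ := by
    ext x
    simp only [Set.mem_ofPred_eq, Set.mem_inter_iff, Set.mem_iInter, Set.mem_compl_iff]
    refine ⟨?_, fun ⟨h1, h2⟩ => ?_⟩
    · rintro rfl
      exact ⟨hc x, hmin x⟩
    · rcases lt_trichotomy (e (c x)) (e i) with h | h | h
      · exact absurd (hc x) (h2 _ h)
      · exact e.injective h
      · exact absurd h1 (hmin x i h)
  rw [this]
  exact (hQ i).inter (MeasurableSet.iInter fun j => MeasurableSet.iInter fun _ => (hQ j).compl)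

lemma measurable_select {α ι : Type*} [MeasurableSpace α] [Finite ι] {c : α → ι}
    (hc : ∀ i, MeasurableSet {x | c x = i}) {F : ι → α → ℝ} (hF : ∀ i, Measurable (F i)) :
    Measurable fun x => F (c x) x := by
  classical
  have := Fintype.ofFinite ι
  have : (fun x => F (c x) x) = fun x => ∑ i, Set.indicator {x | c x = i} (F i) x := by
    funext x
    rw [Finset.sum_eq_single (c x)]
    · simp
    · intro i _ hi
      have hx : x ∉ {x | c x = i} := fun h => hi (Eq.symm h)
      exact Set.indicator_of_notMem hx _
    · simp
  rw [this]
  exact Finset.measurable_sum _ fun i _ => (hF i).indicator (hc i)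

lemma measurableSet_positive : MeasurableSet {s : Fading M L | s.Positive} := by
  have : {s : Fading M L | s.Positive} = ⋂ e, {s | 0 < s e} := by
    ext s; simp [Fading.Positive]
  rw [this]
  exact MeasurableSet.iInter fun e => measurableSet_lt measurable_const (measurable_pi_apply e)

lemma measurable_gain (i : Fin M) (l : Fin L) : Measurable fun s : Fading M L => gain s i l := by
  unfold gain
  fun_prop

lemma measurableSet_useful (i : Fin M) (l : Fin L) :
    MeasurableSet {s : Fading M L | Useful s i l} := by
  have : {s : Fading M L | Useful s i l} = {s | 1 < s (Link.sr l) / s (Link.sd i)} ∩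
      {s | 1 < s (Link.rd l i) / s (Link.sd i)} := rfl
  rw [this]
  exact (measurableSet_lt measurable_const (by fun_prop)).inter
    (measurableSet_lt measurable_const (by fun_prop))

lemma measurableSet_present (j : VUser M) : MeasurableSet {s : Fading M L | Present s j} := by
  rcases j with i | i
  · exact MeasurableSet.univ
  · have : {s : Fading M L | Present s (Sum.inr i)} = ⋃ l, {s | Useful s i l} := by
      ext s; simp [Present]
    rw [this]
    exact MeasurableSet.iUnion fun l => measurableSet_useful i l

lemma measurableSet_isBestRelay (i : Fin M) (l : Fin L) :
    MeasurableSet {s : Fading M L | IsBestRelay s i l} := by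
  have : {s : Fading M L | IsBestRelay s i l} =
      {s | Useful s i l} ∩ ⋂ l', ({s | Useful s i l'}ᶜ ∪ {s | gain s i l' ≤ gain s i l}) := by
    ext s
    simp only [IsBestRelay, Set.mem_ofPred_eq, Set.mem_inter_iff, Set.mem_iInter, Set.mem_union,
      Set.mem_compl_iff, imp_iff_not_or]
  rw [this]
  exact (measurableSet_useful i l).inter (MeasurableSet.iInter fun l' =>
    (measurableSet_useful i l').compl.union
      (measurableSet_le (measurable_gain i l') (measurable_gain i l)))

lemma exists_measurable_relay (hL : 0 < L) (i : Fin M) : ∃ r : Fading M L → Fin L,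
    (∀ s, Present s (Sum.inr i) → IsBestRelay s i (r s)) ∧ ∀ l, MeasurableSet {s | r s = l} := by
  obtain ⟨r, h1, h2⟩ := exists_measurable_selection
    -- The second alternative makes the choice possible in states without a useful relay.
    (Q := fun (s : Fading M L) l => IsBestRelay s i l ∨ ¬ Present s (Sum.inr i))
    (fun l => (measurableSet_isBestRelay i l).union (measurableSet_present (Sum.inr i)).compl) (fun s => by
      by_cases h : Present s (Sum.inr i)
      · obtain ⟨l, hl⟩ := exists_isBestRelay h
        exact ⟨l, Or.inl hl⟩
      · exact ⟨⟨0, hL⟩, Or.inr h⟩)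
  exact ⟨r, fun s hs => (h1 s).resolve_right fun h => h hs, h2⟩

lemma measurable_eta (j : VUser M) : Measurable fun s : Fading M L => eta s j := by
  classical
  rcases j with i | i
  · exact measurable_pi_apply _
  · rcases Nat.eq_zero_or_pos L with rfl | hL
    · have : (fun s : Fading M 0 => eta s (Sum.inr i)) = fun _ => 0 := by
        funext s
        simp [eta, bestGain]
      rw [this]
      exact measurable_const
    obtain ⟨r, h1, h2⟩ := exists_measurable_relay (M := M) hL i
    have : (fun s : Fading M L => eta s (Sum.inr i)) = Set.indicator {s | Present s (Sum.inr i)}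
        (fun s => 2 * s (Link.sd i) * gain s i (r s)) := by
      funext s
      by_cases h : Present s (Sum.inr i)
      · rw [Set.indicator_of_mem (by exact h), (h1 s h).eta_eq]
      · rw [Set.indicator_of_notMem (by exact h), eta, bestGain]
        have : {x | ∃ l, Useful s i l ∧ x = gain s i l} = ∅ :=
          Set.eq_empty_of_forall_notMem fun x ⟨l, hl, _⟩ => h ⟨l, hl⟩
        -- The supremum of the empty set is zero, which agrees with the indicator outside the states
        -- where the DF user is present.
        rw [this, Real.sSup_empty, mul_zero]
    rw [this]
    refine Measurable.indicator ?_ (measurableSet_present _)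
    exact ((measurable_pi_apply _).const_mul 2).mul
      (measurable_select (F := fun l s => gain s i l) h2 fun l => measurable_gain i l)

lemma measurable_waterPower (μ : Fin M → ℝ) (price : ℝ) (j : VUser M) :
    Measurable fun s : Fading M L => waterPower μ price s j := by
  have := measurable_eta (L := L) j
  unfold waterPower
  fun_prop

lemma measurable_optPower (w price : ℝ) : Measurable fun η : ℝ => optPower w η price := by
  unfold optPower
  fun_prop

lemma measurable_optValue (w price : ℝ) : Measurable fun η : ℝ => optValue w η price := by
  have := measurable_optPower w price
  unfold optValue netValue
  fun_prop

lemma measurable_userValue (μ : Fin M → ℝ) (price : ℝ) (j : VUser M) :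
    Measurable fun s : Fading M L => userValue μ price s j :=
  (measurable_optValue (omega μ j) price).comp (measurable_eta j)

lemma measurableSet_isScheduled (μ : Fin M → ℝ) (price : ℝ) (m : VUser M) :
    MeasurableSet {s : Fading M L | IsScheduled μ price s m} := by
  have : {s : Fading M L | IsScheduled μ price s m} = {s | Present s m} ∩
      ⋂ j, ({s | Present s j}ᶜ ∪ {s | userValue μ price s j ≤ userValue μ price s m}) := by
    ext s
    simp only [isScheduled_iff, Set.mem_ofPred_eq, Set.mem_inter_iff, Set.mem_iInter,
      Set.mem_union, Set.mem_compl_iff, imp_iff_not_or]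
  rw [this]
  exact (measurableSet_present m).inter (MeasurableSet.iInter fun j =>
    (measurableSet_present j).compl.union
      (measurableSet_le (measurable_userValue μ price j) (measurable_userValue μ price m)))

/-- A measurable choice of the scheduled user. -/
structure IsScheduler (μ : Fin M → ℝ) (price : ℝ) (c : Fading M L → VUser M) : Prop where
  scheduled : ∀ s, IsScheduled μ price s (c s)
  measurable : ∀ m, MeasurableSet {s | c s = m}

lemma exists_isScheduler (hM : 0 < M) (μ : Fin M → ℝ) (price : ℝ) :
    ∃ c : Fading M L → VUser M, IsScheduler μ price c := by
  obtain ⟨c, h1, h2⟩ := exists_measurable_selection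
    (measurableSet_isScheduled (L := L) μ price) (exists_isScheduled hM μ price)
  exact ⟨c, h1, h2⟩

/-! ## Ties have probability zero -/

/-- Tonelli in coordinate `e`: each fiber has at most one point and the marginal has no atoms. -/
lemma pi_eq_zero_of_fiber {ι : Type*} [Fintype ι] [DecidableEq ι] (ν : ι → Measure ℝ)
    [∀ i, SigmaFinite (ν i)] (e : ι) [NullSingletonClass (ν e)] {S : Set (ι → ℝ)} (hS : MeasurableSet S)
    (h : ∀ s t t', Function.update s e t ∈ S → Function.update s e t' ∈ S → t = t') :
    Measure.pi ν S = 0 := by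
  have hf : Measurable (S.indicator (1 : (ι → ℝ) → ENNReal)) := measurable_one.indicator hS
  rw [← lintegral_indicator_one hS, lintegral_eq_lmarginal_univ (fun _ => 0),
    lmarginal_erase' _ hf (Finset.mem_univ e)]
  have : (fun x => ∫⁻ t, S.indicator (1 : (ι → ℝ) → ENNReal) (Function.update x e t) ∂ν e) =
      fun _ => 0 := by
    funext x
    have hm : Measurable (fun t => Function.update x e t) := measurable_update x
    have : (fun t => S.indicator (1 : (ι → ℝ) → ENNReal) (Function.update x e t)) =
        ((fun t => Function.update x e t) ⁻¹' S).indicator 1 := by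
      funext t
      rfl
    rw [this, lintegral_indicator_one (hm hS)]
    exact Set.Subsingleton.measure_zero (fun t ht t' ht' => h x t t' ht ht') _
  rw [this]
  simp [lmarginal]

section Ties

variable (ν : Link M L → Measure ℝ) [∀ e, IsProbabilityMeasure (ν e)] [∀ e, NullSingletonClass (ν e)]

/-- For fixed `x > 1`, equality of `x * y / (x + y - 1)` at two values of `y` cross-multiplies to `x
* (x - 1)` times their difference being zero. -/
lemma gain_update_inj {s : Fading M L} {i : Fin M} {l : Fin L} {t t' : ℝ}
    (h : Fading.Positive (Function.update s (Link.rd l i) t))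
    (hu : Useful (Function.update s (Link.rd l i) t) i l)
    (hu' : Useful (Function.update s (Link.rd l i) t') i l)
    (heq : gain (Function.update s (Link.rd l i) t) i l =
      gain (Function.update s (Link.rd l i) t') i l) : t = t' := by
  have hg := h (Link.sd i)
  simp only [gain, Useful, Function.update_self, Function.update_of_ne, ne_eq, reduceCtorEq,
    not_false_eq_true, Sum.inr.injEq] at hg hu hu' heq
  obtain ⟨hx, hy⟩ := hu
  obtain ⟨-, hy'⟩ := hu'
  set x := s (Link.sr l) / s (Link.sd i)
  rw [div_eq_div_iff (by linarith) (by linarith)] at heq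
  have h0 : (x * (x - 1)) * (t / s (Link.sd i)) = (x * (x - 1)) * (t' / s (Link.sd i)) := by
    linarith
  have h1 := mul_left_cancel₀ (mul_pos (by linarith) (by linarith)).ne' h0
  field_simp at h1
  exact h1

/-- The relay–user gain enters only the DF link of this one pair, so it can be varied with the
competing value held fixed. At most one of its values produces a tie. -/
lemma pi_relay_tie {μ price : ℝ} (hμ : 0 ≤ μ) (hp : 0 < price) (i : Fin M) (l : Fin L)
    {v : Fading M L → ℝ} (hv : Measurable v)
    (hvu : ∀ s t, v (Function.update s (Link.rd l i) t) = v s) :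
    Measure.pi ν {s : Fading M L | s.Positive ∧ Useful s i l ∧ 0 < v s ∧
      optValue μ (2 * s (Link.sd i) * gain s i l) price = v s} = 0 := by
  refine pi_eq_zero_of_fiber ν (Link.rd l i) ?_ ?_
  · refine measurableSet_positive.inter ((measurableSet_useful i l).inter
      ((measurableSet_lt measurable_const hv).inter (measurableSet_eq_fun ?_ hv)))
    exact (measurable_optValue μ price).comp
      (((measurable_pi_apply _).const_mul 2).mul (measurable_gain i l))
  · rintro s t t' ⟨h1, h2, h3, h4⟩ ⟨h1', h2', -, h4'⟩
    rw [hvu] at h3 h4 h4'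
    have g1 := one_lt_gain h2
    have g2 := one_lt_gain h2'
    have a1 := h1 (Link.sd i)
    have a2 := h1' (Link.sd i)
    have := eq_of_optValue_eq hμ (by positivity) (by positivity) hp h3 h4 h4'
    have e1 : ∀ t, Function.update s (Link.rd l i) t (Link.sd i) = s (Link.sd i) := fun t =>
      Function.update_of_ne (by simp) _ _
    rw [e1] at a1
    rw [e1, e1] at this
    exact gain_update_inj h1 h2 h2' (mul_left_cancel₀ (by positivity) this)

lemma pi_direct_tie {μ price : ℝ} (hμ : 0 ≤ μ) (hp : 0 < price) (i : Fin M)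
    {v : Fading M L → ℝ} (hv : Measurable v)
    (hvu : ∀ s t, v (Function.update s (Link.sd i) t) = v s) :
    Measure.pi ν {s : Fading M L | s.Positive ∧ 0 < v s ∧ optValue μ (s (Link.sd i)) price = v s} = 0 := by
  refine pi_eq_zero_of_fiber ν (Link.sd i) ?_ ?_
  · exact measurableSet_positive.inter ((measurableSet_lt measurable_const hv).inter
      (measurableSet_eq_fun ((measurable_optValue μ price).comp (measurable_pi_apply _)) hv))
  · rintro s t t' ⟨h1, h2, h3⟩ ⟨h1', -, h3'⟩
    rw [hvu] at h2 h3 h3'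
    simpa using eq_of_optValue_eq hμ (h1 _) (h1' _) hp h2 h3 h3'

lemma pi_gain_tie (i : Fin M) {l l' : Fin L} (hne : l ≠ l') :
    Measure.pi ν {s : Fading M L | s.Positive ∧ Useful s i l ∧ gain s i l = gain s i l'} = 0 := by
  refine pi_eq_zero_of_fiber ν (Link.rd l i) ?_ ?_
  · exact measurableSet_positive.inter ((measurableSet_useful i l).inter
      (measurableSet_eq_fun (measurable_gain i l) (measurable_gain i l')))
  · rintro s t t' ⟨h1, h2, h3⟩ ⟨-, h2', h3'⟩
    refine gain_update_inj h1 h2 h2' (h3.trans (Eq.trans ?_ h3'.symm))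
    simp [gain, Ne.symm hne]

/-- Each kind of tie has a link gain that affects one side only. The relay–user link serves for DF
against DF of another user, for DF against DT (the same user included), and for two relays of one
user. The direct link serves for DT against DT. Ranging over all relays avoids analysing the maximum
in the best gain. -/
lemma ae_generic {μ : Fin M → ℝ} {price : ℝ} (hμ : ∀ i, 0 ≤ μ i) (hp : 0 < price)
    (hpos : ∀ᵐ s ∂Measure.pi ν, Fading.Positive s) :
    ∀ᵐ s ∂Measure.pi ν, Generic μ price s := by
  have t1 : ∀ᵐ s ∂Measure.pi ν, ∀ (i i' : Fin M) (l l' : Fin L), i ≠ i' →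
      s ∉ {s : Fading M L | s.Positive ∧ Useful s i l ∧
        0 < optValue (μ i' / 2) (2 * s (Link.sd i') * gain s i' l') price ∧
        optValue (μ i / 2) (2 * s (Link.sd i) * gain s i l) price =
          optValue (μ i' / 2) (2 * s (Link.sd i') * gain s i' l') price} := by
    simp only [ae_all_iff]
    intro i i' l l' hne
    refine measure_eq_zero_iff_ae_notMem.1 (pi_relay_tie ν (omega_nonneg hμ (Sum.inr i)) hp i l
      ((measurable_optValue _ price).comp
        (((measurable_pi_apply _).const_mul 2).mul (measurable_gain i' l'))) fun s t => ?_)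
    simp [gain, Ne.symm hne]
  have t2 : ∀ᵐ s ∂Measure.pi ν, ∀ (i i' : Fin M) (l : Fin L),
      s ∉ {s : Fading M L | s.Positive ∧ Useful s i l ∧
        0 < optValue (μ i') (s (Link.sd i')) price ∧
        optValue (μ i / 2) (2 * s (Link.sd i) * gain s i l) price =
          optValue (μ i') (s (Link.sd i')) price} := by
    simp only [ae_all_iff]
    intro i i' l
    exact measure_eq_zero_iff_ae_notMem.1 (pi_relay_tie ν (omega_nonneg hμ (Sum.inr i)) hp i l
      ((measurable_optValue _ price).comp (measurable_pi_apply _)) fun s t => by simp)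
  have t3 : ∀ᵐ s ∂Measure.pi ν, ∀ (i i' : Fin M), i ≠ i' →
      s ∉ {s : Fading M L | s.Positive ∧ 0 < optValue (μ i') (s (Link.sd i')) price ∧
        optValue (μ i) (s (Link.sd i)) price = optValue (μ i') (s (Link.sd i')) price} := by
    simp only [ae_all_iff]
    intro i i' hne
    exact measure_eq_zero_iff_ae_notMem.1 (pi_direct_tie ν (hμ i) hp i
      ((measurable_optValue _ price).comp (measurable_pi_apply _)) fun s t => by
        simp [Ne.symm hne])
  have t4 : ∀ᵐ s ∂Measure.pi ν, ∀ (i : Fin M) (l l' : Fin L), l ≠ l' →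
      s ∉ {s : Fading M L | s.Positive ∧ Useful s i l ∧ gain s i l = gain s i l'} := by
    simp only [ae_all_iff]
    intro i l l' hne
    exact measure_eq_zero_iff_ae_notMem.1 (pi_gain_tie ν i hne)
  filter_upwards [hpos, t1, t2, t3, t4] with s h0 h1 h2 h3 h4
  refine ⟨h0, fun m m' hm hm' hw => ?_, fun i l l' hl hl' => ?_⟩
  · have hV := (userValue_pos_iff hμ hp h0 hm.1).2 hw
    have heq := hm.userValue_eq hm'
    have hV' := heq ▸ hV
    rw [userValue_eq] at hV hV'
    rw [userValue_eq, userValue_eq] at heq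
    by_contra hne
    rcases m with i | i <;> rcases m' with i' | i'
    · exact h3 i i' (fun h => hne (by rw [h])) ⟨h0, hV', heq⟩
    · obtain ⟨l, hl⟩ := exists_isBestRelay hm'.1
      rw [hl.eta_eq] at heq
      exact h2 i' i l ⟨h0, hl.1, hV, heq.symm⟩
    · obtain ⟨l, hl⟩ := exists_isBestRelay hm.1
      rw [hl.eta_eq] at heq
      exact h2 i i' l ⟨h0, hl.1, hV', heq⟩
    · obtain ⟨l, hl⟩ := exists_isBestRelay hm.1
      obtain ⟨l', hl'⟩ := exists_isBestRelay hm'.1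
      rw [hl.eta_eq, hl'.eta_eq] at heq
      rw [hl'.eta_eq] at hV'
      exact h1 i i' l l' (fun h => hne (by rw [h])) ⟨h0, hl.1, hV', heq⟩
  · by_contra hne
    exact h4 i l l' hne ⟨h0, hl.1, le_antisymm (hl'.2 l hl.1) (hl.2 l' hl'.1)⟩

end Ties

/-! ## Bounds on the scheduled power and rates -/

section Bounds

variable {μ : Fin M → ℝ} {price : ℝ} {s : Fading M L}

lemma omega_le_one (hμ : ∀ i, 0 ≤ μ i) (hμ1 : ∀ i, μ i ≤ 1) (j : VUser M) : omega μ j ≤ 1 := by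
  rcases j with i | i
  · exact hμ1 i
  · have := hμ i
    have := hμ1 i
    simp only [omega]
    linarith

lemma waterPower_le (hμ : ∀ i, 0 ≤ μ i) (hμ1 : ∀ i, μ i ≤ 1) (hp : 0 < price) (hs : s.Positive)
    {j : VUser M} (hj : Present s j) : waterPower μ price s j ≤ 1 / price := by
  refine (optPower_le (omega_nonneg hμ j) (eta_pos hs hj) hp).trans ?_
  exact div_le_div_of_nonneg_right (omega_le_one hμ hμ1 j) hp.le

lemma log_one_add_mul_le {x y : ℝ} (hx : 0 ≤ x) (hy : 0 ≤ y) :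
    Real.log (1 + x * y) ≤ Real.log (1 + x) + Real.log (1 + y) := by
  rw [← Real.log_mul (by positivity) (by positivity)]
  exact Real.log_le_log (by positivity) (by nlinarith)

/-- A bound on the rates of water-filling in terms of the links leaving the source. -/
def rateBound (price : ℝ) (s : Fading M L) : ℝ :=
  ∑ i, Real.log (1 + s (Link.sd i)) + ∑ l, Real.log (1 + s (Link.sr l)) + Real.log (1 + 1 / price)

/-- The power is at most the weight divided by the price. For a DF user the half weight cancels the
factor two in its quality, and the source–relay gain bounds the rest. -/
lemma log_eta_mul_waterPower_le (hμ : ∀ i, 0 ≤ μ i) (hμ1 : ∀ i, μ i ≤ 1) (hp : 0 < price)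
    (hs : s.Positive) {j : VUser M} (hj : Present s j) :
    Real.log (1 + eta s j * waterPower μ price s j) ≤ rateBound price s := by
  have hlog : ∀ e, 0 ≤ Real.log (1 + s e) := fun e => Real.log_nonneg (by linarith [hs e])
  have hsd := Finset.sum_nonneg fun i (_ : i ∈ Finset.univ) => hlog (Link.sd i)
  have hsr := Finset.sum_nonneg fun l (_ : l ∈ Finset.univ) => hlog (Link.sr (M := M) (L := L) l)
  have h0 := mul_nonneg (eta_pos hs hj).le (waterPower_nonneg μ price s j)
  rw [rateBound]
  rcases j with i | i
  · have h1 : eta s (Sum.inl i) * waterPower μ price s (Sum.inl i) ≤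
        s (Link.sd i) * (1 / price) :=
      mul_le_mul_of_nonneg_left (waterPower_le hμ hμ1 hp hs hj) (hs _).le
    have h2 := (Real.log_le_log (by linarith) (add_le_add_right h1 1)).trans
      (log_one_add_mul_le (hs (Link.sd i)).le (by positivity))
    have h3 := Finset.single_le_sum (fun i _ => hlog (Link.sd i)) (Finset.mem_univ i)
    linarith
  · obtain ⟨l, hl⟩ := exists_isBestRelay hj
    have hw : waterPower μ price s (Sum.inr i) ≤ μ i / 2 / price :=
      optPower_le (omega_nonneg hμ (Sum.inr i)) (eta_pos hs hj) hp
    have hw' : waterPower μ price s (Sum.inr i) ≤ 1 / 2 / price :=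
      hw.trans (by have := hμ1 i; gcongr)
    have h1 : eta s (Sum.inr i) * waterPower μ price s (Sum.inr i) ≤
        s (Link.sr l) * (1 / price) := by
      have hg := mul_gain_le hs hl.1
      rw [hl.eta_eq]
      calc 2 * s (Link.sd i) * gain s i l * waterPower μ price s (Sum.inr i)
          = 2 * (s (Link.sd i) * gain s i l) * waterPower μ price s (Sum.inr i) := by ring
        _ ≤ 2 * s (Link.sr l) * (1 / 2 / price) :=
          mul_le_mul (by linarith) hw' (waterPower_nonneg _ _ _ _) (by linarith [hs (Link.sr l)])
        _ = s (Link.sr l) * (1 / price) := by ring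
    have h2 := (Real.log_le_log (by linarith) (add_le_add_right h1 1)).trans
      (log_one_add_mul_le (hs (Link.sr l)).le (by positivity))
    have h3 := Finset.single_le_sum (fun l _ => hlog (Link.sr (M := M) (L := L) l))
      (Finset.mem_univ l)
    linarith

lemma scheduledRate_nonneg (hs : s.Positive) {m : VUser M} (hm : Present s m) (i : Fin M) :
    0 ≤ scheduledRate μ price s m i := by
  have h0 := mul_nonneg (eta_pos hs hm).le (waterPower_nonneg μ price s m)
  refine mul_nonneg ?_ (Real.log_nonneg (by linarith))
  split_ifs <;> norm_num

lemma scheduledRate_le (hμ : ∀ i, 0 ≤ μ i) (hμ1 : ∀ i, μ i ≤ 1) (hp : 0 < price)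
    (hs : s.Positive) {m : VUser M} (hm : Present s m) (i : Fin M) :
    scheduledRate μ price s m i ≤ rateBound price s := by
  have h0 := mul_nonneg (eta_pos hs hm).le (waterPower_nonneg μ price s m)
  have h1 : 0 ≤ Real.log (1 + eta s m * waterPower μ price s m) := Real.log_nonneg (by linarith)
  refine (mul_le_of_le_one_left h1 ?_).trans (log_eta_mul_waterPower_le hμ hμ1 hp hs hm)
  split_ifs <;> norm_num

/-- As the price decreases, the scheduled power grows without bound. -/
lemma exists_price_forall_le_waterPower (hμ : ∀ i, 0 ≤ μ i) (hμ1 : ∀ i, μ i ≤ 1) {i₀ : Fin M}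
    (hi₀ : 0 < μ i₀) (hs : s.Positive) (C : ℝ) : ∃ δ > 0, ∀ price, 0 < price → price < δ →
      ∀ m, IsScheduled μ price s m → C ≤ waterPower μ price s m := by
  -- `K` bounds the net value of a scheduled user with power below `C`, whatever the price. Absolute
  -- values cover absent users and negative `C`.
  set K := ∑ j, Real.log (1 + |eta s j| * |C|) with hK
  have hK0 : ∀ j, 0 ≤ Real.log (1 + |eta s j| * |C|) := fun j =>
    Real.log_nonneg (by have : 0 ≤ |eta s j| * |C| := by positivity
                        linarith)
  have hK1 : 0 ≤ K := Finset.sum_nonneg fun j _ => hK0 j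
  have hg := hs (Link.sd i₀)
  -- At this power the direct link of `i₀` has weighted rate `K + 1`. A price below `1 / (P + 1)`
  -- makes the cost less than one, so its net value beats `K`.
  set P := (Real.exp ((K + 1) / μ i₀) - 1) / s (Link.sd i₀) with hP
  have hP0 : 0 ≤ P := div_nonneg
    (sub_nonneg.2 (Real.one_le_exp (by positivity))) hg.le
  have hfP : f μ s (Sum.inl i₀) P = K + 1 := by
    rw [f, omega, eta, hP, mul_div_cancel₀ _ hg.ne', add_sub_cancel, Real.log_exp,
      mul_div_cancel₀ _ hi₀.ne']
  refine ⟨1 / (P + 1), by positivity, fun price hp hlt m hm => ?_⟩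
  by_contra! hC
  have hw := waterPower_nonneg μ price s m
  have hη := eta_pos hs hm.1
  have h1 : userValue μ price s m ≤ K := by
    have a1 : f μ s m (waterPower μ price s m) ≤
        Real.log (1 + eta s m * waterPower μ price s m) :=
      mul_le_of_le_one_left (Real.log_nonneg (by nlinarith [mul_nonneg hη.le hw]))
        (omega_le_one hμ hμ1 m)
    have a2 : Real.log (1 + eta s m * waterPower μ price s m) ≤
        Real.log (1 + |eta s m| * |C|) := by
      refine Real.log_le_log (by positivity) (add_le_add_right ?_ 1)
      exact mul_le_mul (le_abs_self _) (hC.le.trans (le_abs_self C)) hw (abs_nonneg _)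
    have a3 := Finset.single_le_sum (fun j _ => hK0 j) (Finset.mem_univ m)
    have a4 := mul_nonneg hp.le hw
    rw [userValue]
    linarith
  have h2 := (f_sub_le_userValue hμ hp hs (j := Sum.inl i₀) trivial hP0).trans
    (hm.2 (Sum.inl i₀) trivial)
  change _ ≤ userValue μ price s m at h2
  rw [hfP] at h2
  rw [lt_div_iff₀ (by positivity)] at hlt
  nlinarith

lemma continuousAt_waterPower (hp : 0 < price) (j : VUser M) :
    ContinuousAt (fun p => waterPower μ p s j) price := by
  unfold waterPower
  exact ((continuousAt_const.div continuousAt_id hp.ne').sub continuousAt_const).max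
    continuousAt_const

lemma continuousAt_userValue (hp : 0 < price) (hs : s.Positive) {j : VUser M}
    (hj : Present s j) : ContinuousAt (fun p => userValue μ p s j) price := by
  have h := continuousAt_waterPower (μ := μ) (s := s) hp j
  have h0 := mul_nonneg (eta_pos hs hj).le (waterPower_nonneg μ price s j)
  unfold userValue f
  exact (continuousAt_const.mul ((continuousAt_const.add (continuousAt_const.mul h)).log
    (show 1 + eta s j * waterPower μ price s j ≠ 0 by linarith))).sub (continuousAt_id.mul h)

/-- If the scheduled power is zero at this price, it is squeezed nearby by the sum of all
water-filling powers, which tends to zero. If it is positive, the maximizer is unique and remains so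
in a neighbourhood, where the power is a continuous water-filling expression. -/
lemma Generic.continuousAt_scheduledPower (hμ : ∀ i, 0 ≤ μ i) (hp : 0 < price)
    (h : Generic μ price s) {c : ℝ → VUser M} (hc : ∀ p, IsScheduled μ p s (c p)) :
    ContinuousAt (fun p => waterPower μ p s (c p)) price := by
  classical
  rcases (waterPower_nonneg μ price s (c price)).eq_or_lt with h0 | h0
  · have hle : ∀ p, waterPower μ p s (c p) ≤
        ∑ j ∈ Finset.univ.filter (fun j => Present s j), waterPower μ p s j := fun p =>
      Finset.single_le_sum (f := fun j => waterPower μ p s j)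
        (fun j _ => waterPower_nonneg μ p s j)
        (Finset.mem_filter.2 ⟨Finset.mem_univ _, (hc p).1⟩)
    have hlim : Tendsto (fun p => ∑ j ∈ Finset.univ.filter (fun j => Present s j),
        waterPower μ p s j) (𝓝 price) (𝓝 0) := by
      have := tendsto_finsetSum (Finset.univ.filter (fun j => Present s j)) fun j _ =>
        (continuousAt_waterPower (μ := μ) (s := s) hp j).tendsto
      rwa [Finset.sum_eq_zero fun j hj => (hc price).waterPower_eq_zero hμ hp h.pos h0.symm
        (Finset.mem_filter.1 hj).2] at this
    rw [ContinuousAt, ← h0]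
    exact squeeze_zero (fun p => waterPower_nonneg μ p s _) hle hlim
  · have hev : ∀ᶠ p in 𝓝 price, ∀ j, Present s j → j ≠ c price →
        userValue μ p s j < userValue μ p s (c price) := by
      rw [eventually_all]
      intro j
      by_cases hj : Present s j ∧ j ≠ c price
      · have hlt : userValue μ price s j < userValue μ price s (c price) := by
          by_contra hge
          exact hj.2 (h.scheduled _ _ (hc price) ((hc price).of_le hj.1 (not_lt.1 hge)) h0).symm
        filter_upwards [(continuousAt_userValue hp h.pos hj.1).eventually_lt
          (continuousAt_userValue hp h.pos (hc price).1) hlt] with p hlt' _ _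
        exact hlt'
      · exact Eventually.of_forall fun p h1 h2 => absurd ⟨h1, h2⟩ hj
    refine (continuousAt_waterPower (μ := μ) (s := s) hp (c price)).congr ?_
    filter_upwards [hev] with p hp'
    by_cases heq : c p = c price
    · rw [heq]
    · exact absurd ((hc p).2 _ (hc price).1) (not_le.2 (hp' _ (hc p).1 heq))

end Bounds

/-! ## Means over the fading distribution -/

section Means

variable {μ : Fin M → ℝ} {price : ℝ} {ν : Measure (Fading M L)} [IsProbabilityMeasure ν]
  {c : Fading M L → VUser M}

lemma IsScheduler.measurable_power (hc : IsScheduler μ price c) :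
    Measurable fun s => waterPower μ price s (c s) :=
  measurable_select (F := fun m s => waterPower μ price s m) hc.measurable
    fun m => measurable_waterPower μ price m

lemma IsScheduler.measurable_rate (hc : IsScheduler μ price c) (i : Fin M) :
    Measurable fun s => scheduledRate μ price s (c s) i := by
  refine measurable_select (F := fun m s => scheduledRate μ price s m i) hc.measurable fun m => ?_
  have h1 := measurable_eta (L := L) m
  have h2 := measurable_waterPower (L := L) μ price m
  unfold scheduledRate
  fun_prop

lemma IsScheduler.integrable_power (hc : IsScheduler μ price c) (hμ : ∀ i, 0 ≤ μ i)
    (hμ1 : ∀ i, μ i ≤ 1) (hp : 0 < price) (hpos : ∀ᵐ s ∂ν, s.Positive) :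
    Integrable (fun s => waterPower μ price s (c s)) ν := by
  refine (integrable_const (1 / price)).mono' hc.measurable_power.aestronglyMeasurable ?_
  filter_upwards [hpos] with s hs
  rw [Real.norm_of_nonneg (waterPower_nonneg _ _ _ _)]
  exact waterPower_le hμ hμ1 hp hs (hc.scheduled s).1

lemma IsScheduler.integrable_rate (hc : IsScheduler μ price c) (hμ : ∀ i, 0 ≤ μ i)
    (hμ1 : ∀ i, μ i ≤ 1) (hp : 0 < price) (hpos : ∀ᵐ s ∂ν, s.Positive)
    (hsd : ∀ i, Integrable (fun s => Real.log (1 + s (Link.sd i))) ν)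
    (hsr : ∀ l, Integrable (fun s => Real.log (1 + s (Link.sr l))) ν) (i : Fin M) :
    Integrable (fun s => scheduledRate μ price s (c s) i) ν := by
  have hb : Integrable (rateBound (M := M) (L := L) price) ν :=
    ((integrable_finsetSum _ fun i _ => hsd i).add (integrable_finsetSum _ fun l _ => hsr l)).add
      (integrable_const _)
  refine hb.mono' (hc.measurable_rate i).aestronglyMeasurable ?_
  filter_upwards [hpos] with s hs
  rw [Real.norm_of_nonneg (scheduledRate_nonneg hs (hc.scheduled s).1 i)]
  exact scheduledRate_le hμ hμ1 hp hs (hc.scheduled s).1 i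

variable (ν) in
/-- The mean power of water-filling as a function of the price takes every positive value. -/
lemma exists_price (hM : 0 < M) (hμ : ∀ i, 0 ≤ μ i) (hμ1 : ∀ i, μ i ≤ 1) {i₀ : Fin M}
    (hi₀ : 0 < μ i₀) (hgen : ∀ price, 0 < price → ∀ᵐ s ∂ν, Generic μ price s) {Pbar : ℝ}
    (hP : 0 < Pbar) : ∃ price, 0 < price ∧ ∃ c : Fading M L → VUser M, IsScheduler μ price c ∧
      ∫ s, waterPower μ price s (c s) ∂ν = Pbar := by
  have hpos : ∀ᵐ s ∂ν, s.Positive := (hgen 1 one_pos).mono fun s hs => hs.pos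
  choose c hc using exists_isScheduler (L := L) hM μ
  set H : ℝ → ℝ := fun p => ∫ s, waterPower μ p s (c p s) ∂ν with hH
  have hcont : ContinuousOn H (Set.Ioi 0) := by
    intro p hp
    have hp : 0 < p := hp
    refine (continuousAt_of_dominated (bound := fun _ => 2 / p) ?_ ?_ (integrable_const _)
      ?_).continuousWithinAt
    · exact Eventually.of_forall fun q => (hc q).measurable_power.aestronglyMeasurable
    · filter_upwards [lt_mem_nhds (half_lt_self hp)] with q hq
      filter_upwards [hpos] with s hs
      have hq0 : 0 < q := (half_pos hp).trans hq
      rw [Real.norm_of_nonneg (waterPower_nonneg _ _ _ _)]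
      refine (waterPower_le hμ hμ1 hq0 hs ((hc q).scheduled s).1).trans ?_
      rw [div_le_div_iff₀ hq0 hp]
      linarith
    · filter_upwards [hgen p hp] with s hs
      exact hs.continuousAt_scheduledPower hμ hp fun q => (hc q).scheduled s
  -- Scheduled powers never exceed the inverse of the price.
  have hlow : H (1 / Pbar) ≤ Pbar := by
    have hp : 0 < 1 / Pbar := by positivity
    have := integral_mono_ae ((hc (1 / Pbar)).integrable_power hμ hμ1 hp hpos)
      (integrable_const Pbar) (by
        filter_upwards [hpos] with s hs
        simpa using waterPower_le hμ hμ1 hp hs ((hc (1 / Pbar)).scheduled s).1)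
    simpa using this
  -- Truncating at `Pbar + 1` permits dominated convergence along prices tending to zero; the limit
  -- exceeds `Pbar`.
  have hup : ∃ p, 0 < p ∧ Pbar ≤ H p := by
    have hq : ∀ n : ℕ, 0 < 1 / ((n : ℝ) + 1) := fun n => by positivity
    have hlim : Tendsto (fun n : ℕ => ∫ s, min (waterPower μ (1 / ((n : ℝ) + 1)) s
        (c (1 / ((n : ℝ) + 1)) s)) (Pbar + 1) ∂ν) atTop (𝓝 (∫ _, (Pbar + 1) ∂ν)) := by
      refine tendsto_integral_of_dominated_convergence (fun _ => Pbar + 1)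
        (fun n => ((hc _).measurable_power.min measurable_const).aestronglyMeasurable)
        (integrable_const _) (fun n => Eventually.of_forall fun s => ?_) ?_
      · rw [Real.norm_of_nonneg (le_min (waterPower_nonneg _ _ _ _) (by linarith))]
        exact min_le_right _ _
      · filter_upwards [hpos] with s hs
        obtain ⟨δ, hδ, h⟩ := exists_price_forall_le_waterPower hμ hμ1 hi₀ hs (Pbar + 1)
        refine tendsto_const_nhds.congr' ?_
        filter_upwards [tendsto_one_div_add_atTop_nhds_zero_nat.eventually_lt_const hδ] with n hn
        exact (min_eq_right (h _ (hq n) hn _ ((hc _).scheduled s))).symm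
    rw [integral_const, probReal_univ, one_smul] at hlim
    obtain ⟨n, hn⟩ := (hlim.eventually_const_lt (lt_add_one Pbar)).exists
    have hint := (hc (1 / ((n : ℝ) + 1))).integrable_power (ν := ν) hμ hμ1 (hq n) hpos
    refine ⟨_, hq n, hn.le.trans ?_⟩
    exact integral_mono (hint.inf (integrable_const _)) hint fun s => min_le_left _ _
  obtain ⟨p, hp, hpP⟩ := hup
  obtain ⟨q, hq, hqP⟩ := isPreconnected_Ioi.intermediate_value
    (show 1 / Pbar ∈ Set.Ioi (0 : ℝ) from by simpa using hP) (show p ∈ Set.Ioi (0 : ℝ) from hp)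
    hcont ⟨hlow, hpP⟩
  exact ⟨q, hq, c q, hc q, hqP⟩

end Means

/-! ## Long-term averages -/

lemma longTermAvg_eq_of_tendsto {x : ℕ → ℝ} {a : ℝ} (h : Tendsto (blockAvg x) atTop (𝓝 a)) :
    longTermAvg x = (a : EReal) :=
  ((continuous_coe_real_ereal.tendsto a).comp h).limsup_eq

lemma blockAvg_sum_mul {ι : Type*} (S : Finset ι) (μ : ι → ℝ) (x : ι → ℕ → ℝ) :
    (blockAvg fun k => ∑ i ∈ S, μ i * x i k) = fun K => ∑ i ∈ S, μ i * blockAvg (x i) K := by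
  funext K
  simp only [blockAvg, Finset.mul_sum, ← mul_div_assoc, ← Finset.sum_div]
  rw [Finset.sum_comm]

lemma blockAvg_add_mul (x y : ℕ → ℝ) (c : ℝ) (K : ℕ) :
    blockAvg (fun k => x k + c * y k) K = blockAvg x K + c * blockAvg y K := by
  simp only [blockAvg, Finset.sum_add_distrib, ← Finset.mul_sum]
  ring

/-- Since the averages of `v` converge, only the limit superior of the power has to be controlled.
The gap to any larger `z` is shared equally between the two terms. -/
lemma longTermAvg_le_of_le_add_mul {x v p : ℕ → ℝ} {price Pbar a : ℝ} (hp : 0 < price)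
    (hx : ∀ k, x k ≤ v k + price * p k) (hv : Tendsto (blockAvg v) atTop (𝓝 a))
    (hpow : longTermAvg p ≤ (Pbar : EReal)) :
    longTermAvg x ≤ ((a + price * Pbar : ℝ) : EReal) := by
  rw [← EReal.le_of_forall_lt_iff_le]
  intro z hz
  have hz : a + price * Pbar < z := EReal.coe_lt_coe_iff.1 hz
  set ε := (z - (a + price * Pbar)) / 2 with hε
  have hε0 : 0 < ε := by rw [hε]; linarith
  have hlt : longTermAvg p < ((Pbar + ε / price : ℝ) : EReal) :=
    hpow.trans_lt (EReal.coe_lt_coe_iff.2 (by have : 0 < ε / price := by positivity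
                                              linarith))
  refine limsup_le_of_le (by isBoundedDefault) ?_
  filter_upwards [eventually_lt_of_limsup_lt hlt, hv.eventually_lt_const (lt_add_of_pos_right a hε0)]
    with K h1 h2
  have h1 : blockAvg p K < Pbar + ε / price := EReal.coe_lt_coe_iff.1 h1
  rw [EReal.coe_le_coe_iff]
  have h3 := blockAvg_mono hx K
  rw [blockAvg_add_mul] at h3
  have h4 := mul_lt_mul_of_pos_left h1 hp
  rw [mul_add, mul_div_cancel₀ _ hp.ne'] at h4
  have : z = a + price * Pbar + 2 * ε := by rw [hε]; ring
  linarith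

/-! ## Optimality of water-filling along a realization -/

section Realization

variable {μ : Fin M → ℝ} {price Pbar : ℝ} {g : ℕ → Fading M L} {c : Fading M L → VUser M}
  {R : Fin M → ℝ} {a : ℕ → VirtualAlloc M}

/-- The block averages of scheduled power and rates along `g` converge to `Pbar` and `R`. -/
structure IsTypical (μ : Fin M → ℝ) (price Pbar : ℝ) (c : Fading M L → VUser M) (R : Fin M → ℝ)
    (g : ℕ → Fading M L) : Prop where
  generic : ∀ k, Generic μ price (g k)
  power : Tendsto (blockAvg fun k => waterPower μ price (g k) (c (g k))) atTop (𝓝 Pbar)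
  rate : ∀ i, Tendsto (blockAvg fun k => scheduledRate μ price (g k) (c (g k)) i) atTop (𝓝 (R i))

lemma IsTypical.tendsto_power (hg : IsTypical μ price Pbar c R g)
    (hc : ∀ s, IsScheduled μ price s (c s)) (ha : ∀ k, IsWaterFilling μ price (g k) (a k)) :
    Tendsto (blockAvg fun k => (a k).power) atTop (𝓝 Pbar) := by
  simpa only [fun k => (ha k).power_eq (hg.generic k) (hc _)] using hg.power

lemma IsTypical.tendsto_rate (hg : IsTypical μ price Pbar c R g)
    (hc : ∀ s, IsScheduled μ price s (c s)) (ha : ∀ k, IsWaterFilling μ price (g k) (a k))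
    (i : Fin M) : Tendsto (blockAvg fun k => (a k).rate (g k) i) atTop (𝓝 (R i)) := by
  simpa only [fun k => (ha k).rate_eq (hg.generic k) (hc _)] using hg.rate i

lemma IsTypical.tendsto_objective (hg : IsTypical μ price Pbar c R g)
    (hc : ∀ s, IsScheduled μ price s (c s)) (ha : ∀ k, IsWaterFilling μ price (g k) (a k)) :
    Tendsto (blockAvg fun k => (a k).objective μ (g k)) atTop (𝓝 (∑ i, μ i * R i)) := by
  simp only [VirtualAlloc.objective_eq]
  rw [blockAvg_sum_mul]
  exact tendsto_finsetSum _ fun i _ => (hg.tendsto_rate hc ha i).const_mul (μ i)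

lemma IsTypical.tendsto_userValue (hg : IsTypical μ price Pbar c R g)
    (hc : ∀ s, IsScheduled μ price s (c s)) (ha : ∀ k, IsWaterFilling μ price (g k) (a k)) :
    Tendsto (blockAvg fun k => userValue μ price (g k) (c (g k))) atTop
      (𝓝 (∑ i, μ i * R i - price * Pbar)) := by
  have h := (hg.tendsto_objective hc ha).add ((hg.tendsto_power hc ha).const_mul (-price))
  rw [show ∑ i, μ i * R i + -price * Pbar = ∑ i, μ i * R i - price * Pbar by ring] at h
  refine h.congr fun K => ?_
  rw [← blockAvg_add_mul]
  congr 1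
  funext k
  rw [(ha k).objective_eq (hc _)]
  ring

/-- Averaging the one-block duality bound over a feasible competitor gives exactly the value
attained by water-filling, because the latter uses the whole budget. -/
lemma IsTypical.isOptimal (hg : IsTypical μ price Pbar c R g) (hμ : ∀ i, 0 ≤ μ i)
    (hp : 0 < price) (hc : ∀ s, IsScheduled μ price s (c s))
    (ha : ∀ k, IsWaterFilling μ price (g k) (a k)) : VirtualAlloc.IsOptimal μ Pbar g a := by
  refine ⟨⟨fun k => (ha k).1, (longTermAvg_eq_of_tendsto (hg.tendsto_power hc ha)).le⟩,
    fun b hb => ?_⟩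
  have h := longTermAvg_le_of_le_add_mul (x := fun k => (b k).objective μ (g k)) hp (fun k =>
    VirtualAlloc.objective_le hμ hp (hg.generic k).pos (hb.1 k) (hc (g k)))
    (hg.tendsto_userValue hc ha) hb.2
  rw [sub_add_cancel] at h
  exact h.trans (longTermAvg_eq_of_tendsto (hg.tendsto_objective hc ha)).ge

end Realization

/-! ## The law of large numbers for the fading process -/

section FadingSequence

variable {Ω : Type*} [MeasurableSpace Ω] {Prob : Measure Ω} {γ : ℕ → Ω → Fading M L}
  {ν : Measure (Fading M L)}

/-- The fading states of the blocks are independent with law `ν`. -/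
structure IsIIDFading (Prob : Measure Ω) (γ : ℕ → Ω → Fading M L) (ν : Measure (Fading M L)) :
    Prop where
  measurable : ∀ k, Measurable (γ k)
  map_eq : ∀ k, Prob.map (γ k) = ν
  indep : Pairwise fun k k' => IndepFun (γ k) (γ k') Prob

lemma IsIIDFading.ae (h : IsIIDFading Prob γ ν) {p : Fading M L → Prop} (hp : ∀ᵐ s ∂ν, p s) :
    ∀ᵐ ω ∂Prob, ∀ k, p (γ k ω) := by
  rw [ae_all_iff]
  intro k
  rw [← h.map_eq k] at hp
  exact ae_of_ae_map (h.measurable k).aemeasurable hp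

lemma IsIIDFading.tendsto_blockAvg (h : IsIIDFading Prob γ ν) {φ : Fading M L → ℝ}
    (hφ : Measurable φ) (hint : Integrable φ ν) :
    ∀ᵐ ω ∂Prob, Tendsto (blockAvg fun k => φ (γ k ω)) atTop (𝓝 (∫ s, φ s ∂ν)) := by
  have h0 := hint
  rw [← h.map_eq 0] at h0
  rw [← h.map_eq 0, integral_map (h.measurable 0).aemeasurable hφ.aestronglyMeasurable]
  refine strong_law_ae_real (fun k ω => φ (γ k ω)) (h0.comp_measurable (h.measurable 0))
    (fun k k' hk => (h.indep hk).comp hφ hφ) fun k => ?_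
  exact IdentDistrib.comp ⟨(h.measurable k).aemeasurable, (h.measurable 0).aemeasurable, by
    rw [h.map_eq k, h.map_eq 0]⟩ hφ

/-- Independence over all pairs of block and link gives the product law within a block, and
independence of two blocks because their index sets are disjoint. -/
lemma isIIDFading [IsProbabilityMeasure Prob] (hmeas : ∀ k, Measurable (γ k))
    (hindep : iIndepFun (fun (p : ℕ × Link M L) ω => γ p.1 ω p.2) Prob)
    (hident : ∀ k e, IdentDistrib (fun ω => γ k ω e) (fun ω => γ 0 ω e) Prob Prob) :
    IsIIDFading Prob γ (Measure.pi fun e => Prob.map fun ω => γ 0 ω e) := by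
  classical
  have hme : ∀ k e, Measurable fun ω => γ k ω e := fun k e => (measurable_pi_apply e).comp (hmeas k)
  refine ⟨hmeas, fun k => ?_, fun k k' hk => ?_⟩
  · have h1 : iIndepFun (fun (e : Link M L) ω => γ k ω e) Prob :=
      hindep.precomp (g := fun e => (k, e)) fun e e' h => (Prod.mk.inj h).2
    have h2 := (iIndepFun_iff_map_fun_eq_pi_map fun e => (hme k e).aemeasurable).1 h1
    exact h2.trans (by simp only [(hident k _).map_eq])
  · let S : ℕ → Finset (ℕ × Link M L) := fun k => Finset.univ.image fun e => (k, e)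
    have hS : ∀ k e, (k, e) ∈ S k := fun k e =>
      Finset.mem_image_of_mem (fun e => (k, e)) (Finset.mem_univ e)
    have hd : Disjoint (S k) (S k') := by
      rw [Finset.disjoint_left]
      intro p hp hp'
      obtain ⟨e, -, rfl⟩ := Finset.mem_image.1 hp
      obtain ⟨e', -, he'⟩ := Finset.mem_image.1 hp'
      exact hk (Prod.mk.inj he').1.symm
    have h := hindep.indepFun_finset (S k) (S k') hd fun p => hme p.1 p.2
    have hmr : ∀ k, Measurable fun (x : S k → ℝ) (e : Link M L) => x ⟨(k, e), hS k e⟩ := fun k =>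
      measurable_pi_lambda _ fun e => measurable_pi_apply _
    exact h.comp (hmr k) (hmr k')

/-- The mass of a point is the jump of the distribution function there. -/
lemma nullSingletonClass_of_continuous_cdf (ν : Measure ℝ) [IsProbabilityMeasure ν]
    (h : Continuous (cdf ν)) : NullSingletonClass ν := by
  refine ⟨fun x => ?_⟩
  rw [← measure_cdf ν, StieltjesFunction.measure_singleton,
    h.continuousAt.continuousWithinAt.leftLim_eq, sub_self, ENNReal.ofReal_zero]

variable {price Pbar : ℝ} {V pow obj : Fading M L → ℝ}

/-- The strong law needs integrability, which a policy does not come with. Truncated powers obey it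
and have mean at most `Pbar`; Fatou's lemma removes the truncation, and a second use of the law
gives the bound. -/
lemma IsIIDFading.integrable_of_longTermAvg_le [IsProbabilityMeasure Prob]
    [IsProbabilityMeasure ν] (h : IsIIDFading Prob γ ν) (hpow : Measurable pow)
    (hpow0 : ∀ᵐ s ∂ν, 0 ≤ pow s)
    (hle : ∀ᵐ ω ∂Prob, longTermAvg (fun k => pow (γ k ω)) ≤ (Pbar : EReal)) :
    Integrable pow ν ∧ ∫ s, pow s ∂ν ≤ Pbar := by
  have hmin : ∀ n : ℕ, Integrable (fun s => min (pow s) n) ν := fun n => by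
    refine (integrable_const (n : ℝ)).mono' (hpow.min measurable_const).aestronglyMeasurable ?_
    filter_upwards [hpow0] with s hs
    rw [Real.norm_of_nonneg (le_min hs (Nat.cast_nonneg n))]
    exact min_le_right _ _
  have hminle : ∀ n : ℕ, ∫ s, min (pow s) n ∂ν ≤ Pbar := fun n => by
    obtain ⟨ω, h1, h2⟩ :=
      ((h.tendsto_blockAvg (hpow.min measurable_const) (hmin n)).and hle).exists
    rw [← EReal.coe_le_coe_iff, ← longTermAvg_eq_of_tendsto h1]
    exact (longTermAvg_mono fun k => min_le_left _ _).trans h2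
  have hfin : ∫⁻ s, ENNReal.ofReal (pow s) ∂ν ≤ ENNReal.ofReal Pbar := by
    calc ∫⁻ s, ENNReal.ofReal (pow s) ∂ν
        = ∫⁻ s, liminf (fun n : ℕ => ENNReal.ofReal (min (pow s) n)) atTop ∂ν := by
          refine lintegral_congr fun s => (Tendsto.liminf_eq (tendsto_const_nhds.congr' ?_)).symm
          filter_upwards [eventually_ge_atTop ⌈pow s⌉₊] with n hn
          rw [min_eq_left ((Nat.le_ceil _).trans (Nat.cast_le.2 hn))]
      _ ≤ liminf (fun n : ℕ => ∫⁻ s, ENNReal.ofReal (min (pow s) n) ∂ν) atTop :=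
          lintegral_liminf_le fun n => (hpow.min measurable_const).ennreal_ofReal
      _ ≤ liminf (fun _ : ℕ => ENNReal.ofReal Pbar) atTop := by
          refine liminf_le_liminf (Eventually.of_forall fun n => ?_)
          rw [← ofReal_integral_eq_lintegral_ofReal (hmin n) (by
            filter_upwards [hpow0] with s hs
            exact le_min hs (Nat.cast_nonneg n))]
          exact ENNReal.ofReal_le_ofReal (hminle n)
      _ = ENNReal.ofReal Pbar := liminf_const _
  have hint := (lintegral_ofReal_ne_top_iff_integrable hpow.aestronglyMeasurable hpow0).1
    (ne_top_of_le_ne_top ENNReal.ofReal_ne_top hfin)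
  refine ⟨hint, ?_⟩
  obtain ⟨ω, h1, h2⟩ := ((h.tendsto_blockAvg hpow hint).and hle).exists
  rwa [← EReal.coe_le_coe_iff, ← longTermAvg_eq_of_tendsto h1]

/-- A stationary policy that attains the dual bound has no loss in almost every state. -/
lemma IsIIDFading.ae_eq_of_le_longTermAvg [IsProbabilityMeasure Prob] [IsProbabilityMeasure ν]
    (h : IsIIDFading Prob γ ν) (hp : 0 < price) (hV : Integrable V ν) (hpow : Measurable pow)
    (hobj : Measurable obj) (hpow0 : ∀ᵐ s ∂ν, 0 ≤ pow s) (hobj0 : ∀ᵐ s ∂ν, 0 ≤ obj s)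
    (hobjle : ∀ᵐ s ∂ν, obj s ≤ V s + price * pow s)
    (hle : ∀ᵐ ω ∂Prob, longTermAvg (fun k => pow (γ k ω)) ≤ (Pbar : EReal))
    (hge : ∀ᵐ ω ∂Prob, ((∫ s, V s ∂ν + price * Pbar : ℝ) : EReal) ≤
      longTermAvg fun k => obj (γ k ω)) : ∀ᵐ s ∂ν, obj s = V s + price * pow s := by
  obtain ⟨hpi, hpP⟩ := h.integrable_of_longTermAvg_le hpow hpow0 hle
  have hb : Integrable (fun s => V s + price * pow s) ν := hV.add (hpi.const_mul price)
  have hoi : Integrable obj ν := by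
    refine hb.mono' hobj.aestronglyMeasurable ?_
    filter_upwards [hobj0, hobjle] with s h1 h2
    rwa [Real.norm_of_nonneg h1]
  -- The means are not random, so a single good realization suffices to compare them.
  obtain ⟨ω, h1, h2⟩ := ((h.tendsto_blockAvg hobj hoi).and hge).exists
  rw [longTermAvg_eq_of_tendsto h1, EReal.coe_le_coe_iff] at h2
  have hloss : 0 ≤ᵐ[ν] fun s => V s + price * pow s - obj s := by
    filter_upwards [hobjle] with s hs
    exact sub_nonneg.2 hs
  have hz : ∫ s, (V s + price * pow s - obj s) ∂ν = 0 := by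
    refine le_antisymm ?_ (integral_nonneg_of_ae hloss)
    rw [integral_sub hb hoi, integral_add hV (hpi.const_mul price), integral_const_mul]
    nlinarith
  filter_upwards [(integral_eq_zero_iff_of_nonneg_ae hloss (hb.sub hoi)).1 hz] with s hs
  have hs : V s + price * pow s - obj s = 0 := hs
  linarith

end FadingSequence

/-! ## Policies -/

section Policies

variable {μ : Fin M → ℝ} {price : ℝ} {c : Fading M L → VUser M}

lemma VirtualAlloc.power_nonneg {s : Fading M L} {a : VirtualAlloc M} (ha : a.Admissible s) :
    0 ≤ a.power := Finset.sum_nonneg fun j _ => mul_nonneg (ha.1 j).1 (ha.1 j).2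

lemma VirtualAlloc.objective_nonneg (hμ : ∀ i, 0 ≤ μ i) {s : Fading M L} (hs : s.Positive)
    {a : VirtualAlloc M} (ha : a.Admissible s) : 0 ≤ a.objective μ s := by
  refine Finset.sum_nonneg fun j _ => ?_
  by_cases hj : Present s j
  · have := mul_nonneg (eta_pos hs hj).le (ha.1 j).2
    exact mul_nonneg (ha.1 j).1 (mul_nonneg (omega_nonneg hμ j) (Real.log_nonneg (by linarith)))
  · rw [ha.2.2 j hj, zero_mul]

lemma RelayAlloc.power_nonneg {A : RelayAlloc M L} (hA : A.Admissible) : 0 ≤ A.power := by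
  refine Finset.sum_nonneg fun i _ => ?_
  obtain ⟨h1, h2, h3, h4, h5⟩ := hA.1 i
  exact add_nonneg (mul_nonneg h1 h3) (mul_nonneg h2 (by linarith))

lemma RelayAlloc.objective_nonneg (hμ : ∀ i, 0 ≤ μ i) {s : Fading M L} (hs : s.Positive)
    {A : RelayAlloc M L} (hA : A.Admissible) : 0 ≤ A.objective μ s :=
  Finset.sum_nonneg fun i _ => mul_nonneg (hμ i) (rate_nonneg hs hA i)

lemma VirtualAlloc.IsPolicy.measurable_power {p : Fading M L → VirtualAlloc M}
    (hp : IsPolicy p) : Measurable fun s => (p s).power :=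
  Finset.measurable_sum _ fun j _ => (hp.2 j).1.mul (hp.2 j).2

lemma VirtualAlloc.IsPolicy.measurable_objective {p : Fading M L → VirtualAlloc M}
    (hp : IsPolicy p) : Measurable fun s => (p s).objective μ s :=
  Finset.measurable_sum _ fun j _ => (hp.2 j).1.mul
    ((((measurable_eta j).mul (hp.2 j).2).const_add 1).log.const_mul _)

lemma RelayAlloc.IsPolicy.measurable_power {q : Fading M L → RelayAlloc M L}
    (hq : IsPolicy q) : Measurable fun s => (q s).power := by
  refine Finset.measurable_sum _ fun i _ => ?_
  obtain ⟨h1, h2, -, h4, h5, h6⟩ := hq.2 i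
  exact (h1.mul h4).add (h2.mul ((h5.div_const 2).add (h6.div_const 2)))

lemma RelayAlloc.IsPolicy.measurable_objective {q : Fading M L → RelayAlloc M L}
    (hq : IsPolicy q) : Measurable fun s => (q s).objective μ s := by
  refine Finset.measurable_sum _ fun i _ => Measurable.const_mul ?_ _
  obtain ⟨h1, h2, h3, h4, h5, h6⟩ := hq.2 i
  have hsel : ∀ l, MeasurableSet {s | (q s).relay i = l} := fun l => h3 (measurableSet_singleton l)
  have m1 : Measurable fun s : Fading M L => s (Link.sr ((q s).relay i)) :=
    measurable_select (F := fun l s => s (Link.sr l)) hsel fun l => measurable_pi_apply _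
  have m2 : Measurable fun s : Fading M L => s (Link.rd ((q s).relay i) i) :=
    measurable_select (F := fun l s => s (Link.rd l i)) hsel fun l => measurable_pi_apply _
  have m3 : Measurable fun s : Fading M L => s (Link.sd i) := measurable_pi_apply _
  have m4 : Measurable fun s => (q s).rateDF s i :=
    (((m1.mul h5).const_add 1).log.const_mul _).min
      ((((m3.mul h5).const_add 1).add (m2.mul h6)).log.const_mul _)
  exact (h2.mul m4).add (h1.mul ((m3.mul h4).const_add 1).log)

open Classical in
/-- The water-filling allocation for a given scheduler. -/
def waterFilling (μ : Fin M → ℝ) (price : ℝ) (c : Fading M L → VUser M) (s : Fading M L) :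
    VirtualAlloc M where
  share j := if c s = j then 1 else 0
  pow j := waterPower μ price s j

lemma isWaterFilling_waterFilling (hc : ∀ s, IsScheduled μ price s (c s)) (s : Fading M L) :
    IsWaterFilling μ price s (waterFilling μ price c s) := by
  refine ⟨⟨fun j => ⟨?_, waterPower_nonneg _ _ _ _⟩, ?_, fun j hj => ?_⟩, c s, hc s, ?_, ?_, rfl⟩
  · simp only [waterFilling]
    split_ifs <;> norm_num
  · simp [waterFilling]
  · refine if_neg ?_
    rintro rfl
    exact hj (hc s).1
  · simp [waterFilling]
  · intro l hl
    exact if_neg hl.symm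

lemma IsScheduler.isPolicy_waterFilling (hc : IsScheduler μ price c) :
    VirtualAlloc.IsPolicy (waterFilling μ price c) := by
  classical
  refine ⟨fun s _ => (isWaterFilling_waterFilling hc.scheduled s).1, fun j =>
    ⟨?_, measurable_waterPower μ price j⟩⟩
  exact Measurable.ite (hc.measurable j) measurable_const measurable_const

/-- Every stationary virtual policy is carried out by a stationary relay policy. -/
lemma VirtualAlloc.IsPolicy.exists_relay_policy (hL : 0 < L) {p : Fading M L → VirtualAlloc M}
    (hp : IsPolicy p) : ∃ q : Fading M L → RelayAlloc M L, RelayAlloc.IsPolicy q ∧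
      ∀ s, s.Positive → Realizes s (p s) (q s) := by
  classical
  choose r h1 h2 using exists_measurable_relay (M := M) hL
  have hR : ∀ s, s.Positive → Realizes s (p s) ((p s).toRelay s fun i => r i s) := fun s hs =>
    realizes_toRelay hs (hp.1 s hs) fun i => h1 i s
  refine ⟨fun s => (p s).toRelay s fun i => r i s, ⟨fun s hs => (hR s hs).1, fun i => ?_⟩, hR⟩
  have m1 := (hp.2 (Sum.inr i)).2
  have msp : Measurable fun s => splitPower s i (r i s) ((p s).pow (Sum.inr i)) := by
    refine measurable_select (F := fun l s => splitPower s i l ((p s).pow (Sum.inr i))) (h2 i)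
      fun l => ?_
    unfold splitPower
    fun_prop
  exact ⟨(hp.2 _).1, (hp.2 _).1, measurable_to_countable' (h2 i), (hp.2 _).2,
    Measurable.ite (measurableSet_present _) msp measurable_const,
    Measurable.ite (measurableSet_present _) ((m1.const_mul 2).sub msp) measurable_const⟩

/-- The factor one half in the DF rate agrees with the halved DF weight. The identity reduces
integrability of the scheduled value to that of rates and power. -/
lemma sum_scheduledRate (s : Fading M L) (m : VUser M) :
    ∑ i, μ i * scheduledRate μ price s m i =
      userValue μ price s m + price * waterPower μ price s m := by
  rw [userValue, f, sub_add_cancel]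
  rcases m with i | i
  · rw [Finset.sum_eq_single i (fun j _ hj => by simp [scheduledRate, hj.symm]) (by simp)]
    simp [scheduledRate, omega]
  · rw [Finset.sum_eq_single i (fun j _ hj => by simp [scheduledRate, hj.symm]) (by simp)]
    simp only [scheduledRate, omega, reduceCtorEq, if_false, if_true]
    ring

end Policies

end RelayBC

end

/-! ### Assembly of the two claims -/

theorem mainTheorem1 {M L : ℕ} (hL : 0 < L)
    {Ω : Type*} [MeasurableSpace Ω] (Prob : Measure Ω) [IsProbabilityMeasure Prob]
    -- the fading process; `γ k ω e` is the gain of link `e` in block `k`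
    (γ : ℕ → Ω → RelayBC.Fading M L)
    (hmeas : ∀ k, Measurable (γ k))
    -- gains are independent across links and blocks, and stationary
    (hindep : iIndepFun (fun (p : ℕ × RelayBC.Link M L) ω => γ p.1 ω p.2) Prob)
    (hident : ∀ k e, IdentDistrib (fun ω => γ k ω e) (fun ω => γ 0 ω e) Prob Prob)
    (hnonneg : ∀ e, ∀ᵐ ω ∂Prob, 0 ≤ γ 0 ω e)
    -- continuous fading distributions
    (hcdf : ∀ e, Continuous (cdf (Prob.map fun ω => γ 0 ω e)))
    -- the links leaving the source have finite ergodic capacity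
    (hsd : ∀ i, Integrable (fun ω => Real.log (1 + γ 0 ω (RelayBC.Link.sd i))) Prob)
    (hsr : ∀ l, Integrable (fun ω => Real.log (1 + γ 0 ω (RelayBC.Link.sr l))) Prob)
    (μ : Fin M → ℝ) (hμ : ∀ i, 0 ≤ μ i) (hμsum : ∑ i, μ i = 1)
    (Pbar : ℝ) (hP : 0 < Pbar) :
    -- virtual allocations are carried out by relay allocations of equal power and rates
    (∀ s : RelayBC.Fading M L, s.Positive → ∀ a : RelayBC.VirtualAlloc M, a.Admissible s →
      (∃ A : RelayBC.RelayAlloc M L, RelayBC.Realizes s a A) ∧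
      ∀ A : RelayBC.RelayAlloc M L, RelayBC.Realizes s a A →
        A.power = a.power ∧ (∀ i, A.rate s i = a.rate s i) ∧
          A.objective μ s = a.objective μ s) ∧
    -- for every realization of the fading both problems have the same achievable rates region,
    -- the same attainable weighted sum rates, and corresponding solutions
    (∀ g : ℕ → RelayBC.Fading M L, (∀ k, (g k).Positive) →
      RelayBC.RelayAlloc.region Pbar g = RelayBC.VirtualAlloc.region Pbar g ∧
      RelayBC.RelayAlloc.values μ Pbar g = RelayBC.VirtualAlloc.values μ Pbar g ∧
      ∀ (a : ℕ → RelayBC.VirtualAlloc M) (A : ℕ → RelayBC.RelayAlloc M L),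
        (∀ k, (a k).Admissible (g k)) → (∀ k, RelayBC.Realizes (g k) (a k) (A k)) →
        (RelayBC.RelayAlloc.IsOptimal μ Pbar g A ↔
          RelayBC.VirtualAlloc.IsOptimal μ Pbar g a)) ∧
    -- almost surely all gains are positive in all blocks
    (∀ᵐ ω ∂Prob, ∀ k, (γ k ω).Positive) ∧
    ∃ price : ℝ, 0 < price ∧ ∃ R : Fin M → ℝ,
      -- the scheduled virtual user is almost surely unique when it is given power
      (∀ᵐ ω ∂Prob, ∀ k m m', RelayBC.IsScheduled μ price (γ k ω) m →
        RelayBC.IsScheduled μ price (γ k ω) m' →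
        0 < RelayBC.waterPower μ price (γ k ω) m → m = m') ∧
      -- the policies exist in both channels
      (∃ (p : RelayBC.Fading M L → RelayBC.VirtualAlloc M)
        (q : RelayBC.Fading M L → RelayBC.RelayAlloc M L),
        RelayBC.VirtualAlloc.IsPolicy p ∧ RelayBC.RelayAlloc.IsPolicy q ∧
        ∀ s : RelayBC.Fading M L, s.Positive →
          RelayBC.IsWaterFilling μ price s (p s) ∧ RelayBC.Realizes s (p s) (q s)) ∧
      -- optimality, among all sequences of allocations, in both channels
      (∀ᵐ ω ∂Prob, ∀ a : ℕ → RelayBC.VirtualAlloc M,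
        (∀ k, RelayBC.IsWaterFilling μ price (γ k ω) (a k)) →
        RelayBC.VirtualAlloc.IsOptimal μ Pbar (fun k => γ k ω) a ∧
        Tendsto (RelayBC.blockAvg fun k => (a k).power) atTop (𝓝 Pbar) ∧
        (∀ i, Tendsto (RelayBC.blockAvg fun k => (a k).rate (γ k ω) i) atTop (𝓝 (R i))) ∧
        RelayBC.longTermAvg (fun k => (a k).objective μ (γ k ω)) =
          ((∑ i, μ i * R i : ℝ) : EReal) ∧
        ∀ A : ℕ → RelayBC.RelayAlloc M L, (∀ k, RelayBC.Realizes (γ k ω) (a k) (A k)) →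
          RelayBC.RelayAlloc.IsOptimal μ Pbar (fun k => γ k ω) A) ∧
      -- uniqueness among policies of the broadcast channel with virtual users
      (∀ p : RelayBC.Fading M L → RelayBC.VirtualAlloc M, RelayBC.VirtualAlloc.IsPolicy p →
        (∀ᵐ ω ∂Prob, RelayBC.VirtualAlloc.IsOptimal μ Pbar (fun k => γ k ω)
          (fun k => p (γ k ω))) →
        ∀ᵐ ω ∂Prob, ∀ k, ∀ a : RelayBC.VirtualAlloc M,
          RelayBC.IsWaterFilling μ price (γ k ω) a → (p (γ k ω)).active = a.active) ∧
      -- uniqueness among policies of the relay-assisted channel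
      (∀ q : RelayBC.Fading M L → RelayBC.RelayAlloc M L, RelayBC.RelayAlloc.IsPolicy q →
        (∀ᵐ ω ∂Prob, RelayBC.RelayAlloc.IsOptimal μ Pbar (fun k => γ k ω)
          (fun k => q (γ k ω))) →
        ∀ᵐ ω ∂Prob, ∀ k, ∀ (a : RelayBC.VirtualAlloc M) (A : RelayBC.RelayAlloc M L),
          RelayBC.IsWaterFilling μ price (γ k ω) a → RelayBC.Realizes (γ k ω) a A →
          (q (γ k ω)).activeDT = A.activeDT ∧ (q (γ k ω)).activeDF = A.activeDF) := by
  have hM : 0 < M := by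
    rcases Nat.eq_zero_or_pos M with rfl | h
    · simp at hμsum
    · exact h
  have hμ1 : ∀ i, μ i ≤ 1 := fun i =>
    hμsum ▸ Finset.single_le_sum (fun i _ => hμ i) (Finset.mem_univ i)
  obtain ⟨i₀, hi₀⟩ : ∃ i, 0 < μ i := by
    by_contra! h
    have := Finset.sum_nonpos fun i (_ : i ∈ Finset.univ) => h i
    linarith
  have hme : ∀ e, Measurable fun ω => γ 0 ω e := fun e => (measurable_pi_apply e).comp (hmeas 0)
  have : ∀ e, IsProbabilityMeasure (Prob.map fun ω => γ 0 ω e) := fun e =>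
    Measure.isProbabilityMeasure_map (hme e).aemeasurable
  have : ∀ e, NullSingletonClass (Prob.map fun ω => γ 0 ω e) := fun e =>
    RelayBC.nullSingletonClass_of_continuous_cdf _ (hcdf e)
  have hiid := RelayBC.isIIDFading hmeas hindep hident
  set ν := Measure.pi fun e => Prob.map fun ω => γ 0 ω e with hν
  have hpos : ∀ᵐ s ∂ν, RelayBC.Fading.Positive s := by
    rw [← hiid.map_eq 0, ae_map_iff (hmeas 0).aemeasurable RelayBC.measurableSet_positive]
    refine ae_all_iff.2 fun e => ?_
    -- A continuous law has no atom at zero, so nonnegative gains are almost surely positive.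
    have h0 : ∀ᵐ ω ∂Prob, γ 0 ω e ≠ 0 :=
      ae_of_ae_map (hme e).aemeasurable (Measure.ae_ne _ (0 : ℝ))
    filter_upwards [hnonneg e, h0] with ω h1 h2
    exact lt_of_le_of_ne h1 (Ne.symm h2)
  have hgen : ∀ price, 0 < price → ∀ᵐ s ∂ν, RelayBC.Generic μ price s := fun price hp =>
    RelayBC.ae_generic _ hμ hp hpos
  have hlog : ∀ e, Integrable (fun ω => Real.log (1 + γ 0 ω e)) Prob →
      Integrable (fun s : RelayBC.Fading M L => Real.log (1 + s e)) ν := by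
    intro e he
    rw [← hiid.map_eq 0]
    exact (integrable_map_measure ((measurable_pi_apply e).const_add 1).log.aestronglyMeasurable
      (hmeas 0).aemeasurable).2 he
  refine ⟨fun s hs a ha => ⟨RelayBC.exists_realizes hL hs ha, fun A hA =>
      ⟨hA.power_eq ha, hA.rate_eq hs ha, hA.objective_eq hs ha μ⟩⟩,
    fun g hg => ⟨RelayBC.region_eq hL hg Pbar, RelayBC.values_eq hL hg Pbar μ,
      fun a A ha hA => RelayBC.isOptimal_iff hL hg ha hA⟩, hiid.ae hpos, ?_⟩
  obtain ⟨price, hp, c, hc, hcP⟩ := RelayBC.exists_price ν hM hμ hμ1 hi₀ hgen hP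
  have hrate := hc.integrable_rate (ν := ν) hμ hμ1 hp hpos (fun i => hlog _ (hsd i))
    fun l => hlog _ (hsr l)
  have hpow := hc.integrable_power (ν := ν) hμ hμ1 hp hpos
  set R : Fin M → ℝ := fun i => ∫ s, RelayBC.scheduledRate μ price s (c s) i ∂ν with hR
  -- This event is fixed before any allocation is, so optimality holds on it against all sequences,
  -- including those that depend on the whole realization.
  have htyp : ∀ᵐ ω ∂Prob, RelayBC.IsTypical μ price Pbar c R fun k => γ k ω := by
    filter_upwards [hiid.ae (hgen price hp), hiid.tendsto_blockAvg hc.measurable_power hpow,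
      ae_all_iff.2 fun i => hiid.tendsto_blockAvg (hc.measurable_rate i) (hrate i)]
      with ω h1 h2 h3
    exact ⟨h1, hcP ▸ h2, h3⟩
  have hVeq : (fun s => RelayBC.userValue μ price s (c s)) = fun s =>
      ∑ i, μ i * RelayBC.scheduledRate μ price s (c s) i -
        price * RelayBC.waterPower μ price s (c s) := by
    funext s
    rw [RelayBC.sum_scheduledRate]
    ring
  have hsum : Integrable (fun s => ∑ i, μ i * RelayBC.scheduledRate μ price s (c s) i) ν :=
    integrable_finsetSum _ fun i _ => (hrate i).const_mul (μ i)
  have hV : Integrable (fun s => RelayBC.userValue μ price s (c s)) ν := by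
    rw [hVeq]
    exact hsum.sub (hpow.const_mul price)
  -- No duality gap: the dual bound at this price equals the weighted sum rate of water-filling.
  have hVint : ∫ s, RelayBC.userValue μ price s (c s) ∂ν + price * Pbar = ∑ i, μ i * R i := by
    rw [hVeq, integral_sub hsum (hpow.const_mul price), integral_const_mul, hcP,
      integral_finsetSum _ fun i _ => (hrate i).const_mul (μ i), sub_add_cancel]
    simp only [integral_const_mul, hR]
  have hp₀ := hc.isPolicy_waterFilling
  obtain ⟨q₀, hq₀, hreal⟩ := hp₀.exists_relay_policy hL
  have hwf := RelayBC.isWaterFilling_waterFilling hc.scheduled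
  refine ⟨price, hp, R, ?_, ⟨_, q₀, hp₀, hq₀, fun s hs => ⟨hwf s, hreal s hs⟩⟩, ?_, ?_, ?_⟩
  · filter_upwards [htyp] with ω h k
    exact (h.generic k).scheduled
  · filter_upwards [htyp] with ω h a ha
    have hopt := h.isOptimal hμ hp hc.scheduled ha
    exact ⟨hopt, h.tendsto_power hc.scheduled ha, h.tendsto_rate hc.scheduled ha,
      RelayBC.longTermAvg_eq_of_tendsto (h.tendsto_objective hc.scheduled ha), fun A hA =>
      (RelayBC.isOptimal_iff hL (fun k => (h.generic k).pos) (fun k => (ha k).1) hA).2 hopt⟩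
  · intro p hpol hopt
    have hz := hiid.ae_eq_of_le_longTermAvg hp hV hpol.measurable_power
      (hpol.measurable_objective (μ := μ))
      (hpos.mono fun s hs => RelayBC.VirtualAlloc.power_nonneg (hpol.1 s hs))
      (hpos.mono fun s hs => RelayBC.VirtualAlloc.objective_nonneg hμ hs (hpol.1 s hs))
      (hpos.mono fun s hs =>
        RelayBC.VirtualAlloc.objective_le hμ hp hs (hpol.1 s hs) (hc.scheduled s))
      (hopt.mono fun ω h => h.1.2) (by
        -- Water-filling is a feasible competitor, so an optimal policy reaches at least the dual
        -- bound.
        filter_upwards [hopt, htyp] with ω h1 h2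
        have ha := fun k => hwf (γ k ω)
        rw [hVint, ← RelayBC.longTermAvg_eq_of_tendsto (h2.tendsto_objective hc.scheduled ha)]
        exact h1.2 _ (h2.isOptimal hμ hp hc.scheduled ha).1)
    filter_upwards [hiid.ae hz, hiid.ae (hgen price hp)] with ω h1 h2 k a ha
    exact RelayBC.VirtualAlloc.active_eq hμ hp (h2 k) (hpol.1 _ (h2 k).pos) ha
      (hc.scheduled _) (h1 k)
  · intro q hpol hopt
    have hz := hiid.ae_eq_of_le_longTermAvg hp hV hpol.measurable_power
      (hpol.measurable_objective (μ := μ))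
      (hpos.mono fun s hs => RelayBC.RelayAlloc.power_nonneg (hpol.1 s hs))
      (hpos.mono fun s hs => RelayBC.RelayAlloc.objective_nonneg hμ hs (hpol.1 s hs))
      (hpos.mono fun s hs =>
        RelayBC.RelayAlloc.objective_le hμ hp hs (hpol.1 s hs) (hc.scheduled s))
      (hopt.mono fun ω h => h.1.2) (by
        filter_upwards [hopt, htyp] with ω h1 h2
        have ha := fun k => hwf (γ k ω)
        have hs := fun k => (h2.generic k).pos
        have hr := fun k => hreal (γ k ω) (hs k)
        -- The competitor here is water-filling carried out with relays; the equivalence supplies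
        -- its feasibility.
        have h3 := (RelayBC.isOptimal_iff hL hs (fun k => (ha k).1) hr).2
          (h2.isOptimal hμ hp hc.scheduled ha)
        rw [hVint, ← RelayBC.longTermAvg_eq_of_tendsto (h2.tendsto_objective hc.scheduled ha)]
        simpa only [fun k => (hr k).objective_eq (hs k) (ha k).1 μ] using h1.2 _ h3.1)
    filter_upwards [hiid.ae hz, hiid.ae (hgen price hp)] with ω h1 h2 k a A ha hA
    exact RelayBC.RelayAlloc.active_eq hμ hp (h2 k) (hpol.1 _ (h2 k).pos) ha hA
      (hc.scheduled _) (h1 k)
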